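/- **Conventions.** An $n$-manifold is a connected Hausdorff space each of whose points has an open neighborhood homeomorphic to $\mathbb{R}^n$ (no boundary; no countability condition). $\mathbb{L}_{\ge 0}$ is the closed long ray, i.e. $\omega_1\times[0,1)$ with the lexicographic order topology. A space $X$ is *Type I* if it is not Lindelöf and $X=\bigcup_{\alpha<\omega_1}X_\alpha$ with each $X_\alpha$ open, each $\overline{X_\alpha}$ Lindelöf, and $\overline{X_\alpha}\subset X_\beta$ whenever $\alpha<\beta$. A subset of $X$ is *bounded* if it is contained in some $X_\alpha$ (this does not depend on the sequence), and *club* if it is closed and unbounded. A continuous map $f:X\to\mathbb{L}_{\ge0}$ is *bounded on* $A\subset X$ if $f(A)$ is bounded in $\mathbb{L}_{\ge 0}$ (equivalently, bounded above), and *unbounded* if it is not bounded on $X$. For $A,B\subset X$ write $A\preceq B$ if every continuous $f:X\to\mathbb{L}_{\ge 0}$ that is unbounded on $A$ is unbounded on $B$. A *direction* in $X$ is a club set $D\subset X$ such that $C\preceq D$ and $D\preceq C$ for every club $C\subset D$. $X$ is *spanned by directions* if every open subset of $X$ that contains a club set contains a direction. $X$ is *$\omega_1$-compact* if it has no uncountable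 closed discrete subset, and *$\omega$-bounded* if every countable subset has compact closure. $\neg\mathbf{SH}$ says that there is a Suslin tree: a tree of cardinality $\aleph_1$ all of whose chains and antichains are countable. $\diamondsuit^+$ says that there are countable families $\mathcal{A}_\alpha\subset\mathcal{P}(\alpha)$ $(\alpha<\omega_1)$ such that for every $A\subset\omega_1$ there is a closed unbounded $C\subset\omega_1$ with $A\cap\alpha\in\mathcal{A}_\alpha$ and $C\cap\alpha\in\mathcal{A}_\alpha$ for all $\alpha\in C$. **Theorem 5.2.** (a) If $\neg\mathbf{SH}$ holds, then there is an $\omega_1$-compact Type I $3$-manifold $M$, spanned by directions, and an unbounded continuous map $f:M\to\mathbb{L}_{\ge 0}$ that is bounded on each direction in $M$. (b) Suppose that Nyikos's (unpublished) claim is correct, namely that $\diamondsuit^+$ implies the existence of an $\omega$-bounded Type I $2$-manifold containing no direction. If $\diamondsuit^+$ holds, then there is an $\omega$-bounded Type I $3$-manifold $M$, spanned by directions, and an unbounded continuous map $f:M\to\mathbb{L}_{\ge 0}$ that is bounded on each direction in $M$. -/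

import Mathlib

open Set Topology
open scoped Cardinal

namespace Directions

/-! ### The ordinal `ω₁` and the closed long ray -/

/-- The set of countable ordinals with its well-order. -/
abbrev Omega1 : Type := (Ordinal.omega 1 : Ordinal.{0}).ToType

/-- The closed long ray: `ω₁ × [0, 1)` with the lexicographic order. -/
def LongRay : Type := Omega1 ×ₗ Set.Ico (0 : ℝ) 1

noncomputable instance : LinearOrder LongRay :=
  inferInstanceAs (LinearOrder (Omega1 ×ₗ Set.Ico (0 : ℝ) 1))

/-- The long ray carries the order topology. -/
noncomputable instance : TopologicalSpace LongRay := Preorder.topology LongRay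

instance : OrderTopology LongRay := ⟨rfl⟩

/-! ### Type I spaces -/

/-- The sequence `U` exhibits `X` as a Type I space. -/
structure IsTypeISeq {X : Type*} [TopologicalSpace X] (U : Omega1 → Set X) : Prop where
  isOpen : ∀ α, IsOpen (U α)
  isLindelof_closure : ∀ α, IsLindelof (closure (U α))
  closure_subset : ∀ α β, α < β → closure (U α) ⊆ U β
  iUnion_eq : ⋃ α, U α = univ

/-- Type I spaces; as usual in this context, Lindelöf spaces are excluded. -/
def IsTypeI (X : Type*) [TopologicalSpace X] : Prop :=
  (∃ U : Omega1 → Set X, IsTypeISeq U) ∧ ¬ LindelofSpace X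

/-- Bounded subsets of a Type I space: those contained in a member of a sequence exhibiting the
space as Type I. The choice of the sequence does not matter, see `isBounded_iff`. -/
def IsBounded {X : Type*} [TopologicalSpace X] (A : Set X) : Prop :=
  ∃ U : Omega1 → Set X, IsTypeISeq U ∧ ∃ α, A ⊆ U α

theorem exists_gt_of_countable {r : Set Omega1} (hr : r.Countable) : ∃ β, ∀ α ∈ r, α < β := by
  have : Countable r := hr.to_subtype
  let g : r → Ordinal.{0} := fun i => Order.succ (i.1.toOrd : Ordinal.{0})
  have hlim : Order.IsSuccLimit (Ordinal.omega 1 : Ordinal.{0}) := Cardinal.isSuccLimit_omega 1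
  have hg : ∀ i, g i < Ordinal.omega 1 := fun i => hlim.succ_lt i.1.toOrd.2
  have hs : iSup g < Ordinal.omega 1 := Ordinal.iSup_lt_omega_one hg
  refine ⟨Ordinal.ToType.mk ⟨iSup g, hs⟩, fun α hα => ?_⟩
  rw [← OrderIso.symm_apply_lt]
  have h : (α.toOrd : Ordinal.{0}) < iSup g :=
    lt_of_lt_of_le (Order.lt_succ _) (Ordinal.le_iSup g ⟨α, hα⟩)
  exact h

theorem isBounded_iff {X : Type*} [TopologicalSpace X] {U : Omega1 → Set X} (hU : IsTypeISeq U)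
    {A : Set X} : IsBounded A ↔ ∃ α, A ⊆ U α := by
  refine ⟨?_, fun h => ⟨U, hU, h⟩⟩
  rintro ⟨V, hV, α, hA⟩
  obtain ⟨r, hr, hsub⟩ := (hV.isLindelof_closure α).elim_countable_subcover U hU.isOpen
    (by rw [hU.iUnion_eq]; exact subset_univ _)
  obtain ⟨β, hβ⟩ := exists_gt_of_countable hr
  refine ⟨β, fun x hx => ?_⟩
  obtain ⟨i, hi, hxi⟩ := mem_iUnion₂.1 (hsub (subset_closure (hA hx)))
  exact hU.closure_subset i β (hβ i hi) (subset_closure hxi)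

/-- Closed and unbounded subsets of a Type I space. -/
def IsClubSet {X : Type*} [TopologicalSpace X] (C : Set X) : Prop :=
  IsClosed C ∧ ¬ IsBounded C

/-! ### Directions

A subset of the long ray is bounded in the sense of Type I spaces if and only if it is bounded
above in the order of the long ray. -/

/-- The continuous map `f` to the long ray is bounded on `A`. -/
def BoundedOn {X : Type*} [TopologicalSpace X] (f : C(X, LongRay)) (A : Set X) : Prop :=
  BddAbove (f '' A)

/-- The unbounded function order on the subsets of `X`. -/
def UfoLE {X : Type*} [TopologicalSpace X] (A B : Set X) : Prop :=
  ∀ f : C(X, LongRay), ¬ BoundedOn f A → ¬ BoundedOn f B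

/-- A direction in `X` is a closed unbounded set that is equivalent, in the unbounded function
order, to each of its closed unbounded subsets. -/
def IsDirection {X : Type*} [TopologicalSpace X] (D : Set X) : Prop :=
  IsClubSet D ∧ ∀ C : Set X, C ⊆ D → IsClubSet C → UfoLE C D ∧ UfoLE D C

/-- An open set is large if it contains a closed unbounded set. A space is spanned by directions
if each large open set contains a direction. -/
def SpannedByDirections (X : Type*) [TopologicalSpace X] : Prop :=
  ∀ U : Set X, IsOpen U → (∃ C ⊆ U, IsClubSet C) → ∃ D ⊆ U, IsDirection D

/-! ### Classes of spaces -/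

/-- There is no uncountable closed discrete subset. -/
def IsOmega1Compact (X : Type*) [TopologicalSpace X] : Prop :=
  ∀ D : Set X, IsClosed D → IsDiscrete D → D.Countable

/-- The closure of each countable subset is compact. -/
def IsOmegaBounded (X : Type*) [TopologicalSpace X] : Prop :=
  ∀ A : Set X, A.Countable → IsCompact (closure A)

/-- Topological `n`-manifolds (without boundary): connected Hausdorff spaces each point of which
has an open neighborhood homeomorphic to `ℝⁿ`. No countability is assumed. -/
structure IsTopManifold (n : ℕ) (X : Type*) [TopologicalSpace X] : Prop where
  t2 : T2Space X
  connected : ConnectedSpace X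
  locally_euclidean : ∀ x : X, ∃ U : Set X, IsOpen U ∧ x ∈ U ∧
    Nonempty (U ≃ₜ EuclideanSpace ℝ (Fin n))

/-! ### Set-theoretic hypotheses -/

/-- Suslin trees: trees of size `ℵ₁` in which all chains and all antichains are countable. -/
structure IsSuslinTree (T : Type*) [PartialOrder T] : Prop where
  /-- The predecessors of each element are well-ordered. -/
  isWF_Iio : ∀ x : T, (Iio x).IsWF
  isChain_Iio : ∀ x : T, IsChain (· ≤ ·) (Iio x)
  card_eq : #T = Cardinal.aleph 1
  countable_of_isChain : ∀ C : Set T, IsChain (· ≤ ·) C → C.Countable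
  countable_of_isAntichain : ∀ A : Set T, IsAntichain (· ≤ ·) A → A.Countable

/-- The negation of Suslin's hypothesis: there is a Suslin tree. -/
def NotSH : Prop := ∃ (T : Type) (_ : PartialOrder T), IsSuslinTree T

/-- The principle `◇⁺`: there are countable families `𝒜 α` of subsets of `α`, for `α < ω₁`, such
that for each `A ⊆ ω₁` there is a closed unbounded `C ⊆ ω₁` with `A ∩ α ∈ 𝒜 α` and
`C ∩ α ∈ 𝒜 α` for all `α ∈ C`. Here `α` is identified with the set `Iio α`. -/
def DiamondPlus : Prop :=
  ∃ 𝒜 : Omega1 → Set (Set Omega1),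
    (∀ α, (𝒜 α).Countable ∧ ∀ S ∈ 𝒜 α, S ⊆ Iio α) ∧
    ∀ A : Set Omega1, ∃ C : Set Omega1, IsClub C ∧
      ∀ α ∈ C, A ∩ Iio α ∈ 𝒜 α ∧ C ∩ Iio α ∈ 𝒜 α

/-- There is an `ω`-bounded Type I surface that contains no direction. -/
def NyikosSurface : Prop :=
  ∃ (N : Type) (_ : TopologicalSpace N), IsTopManifold 2 N ∧ IsTypeI N ∧ IsOmegaBounded N ∧
    ∀ D : Set N, ¬ IsDirection D

end Directions

namespace Directions

/-! ### Countable ordinals -/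

/-! Let `N` be a surface with an unbounded map `g` to the long ray whose sublevel sets are Lindelöf.
The 3-manifold is `Double g`: two copies of the region above the graph of `g`, glued along the graph
and realised as the triples `(x, y, z)` with `min y z = g x`. The required function is the height `g
∘ base`. It is constant on the vertical long rays over points of `N`, and these rays supply all the
directions that are needed.

Spanning (`Double.spannedByDirections`): let `C` be a club set in an open set `U`. If a part of `C`
of bounded height is unbounded, the Lindelöf sublevel sets of `g` force `C` to accumulate
unboundedly along one vertical ray. The trace of `C` on this ray is a direction, because closed
unbounded subsets of the long ray meet. Otherwise `C` contains points of arbitrarily large height,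
and `ω₁`-compactness of `N` makes a rapidly climbing `ω₁`-sequence in `C` accumulate on the gluing
locus, at a point of `U`. If every vertical ray left `U`, the exit parameters could be built into
the sequence, and an exit point would fall into a small box inside `U`. So some whole vertical ray
lies in `U`.

Boundedness (`Double.boundedOn_of_isDirection`): suppose that the height is unbounded on a closed
set `D`. The base is required to provide a map `F` that is unbounded on the projection of `D` but
bounded on a part of it of unbounded height. Then `F ∘ base` shows that `D` is not a direction.

For (b), `N` is Nyikos's surface, `g` comes from `exists_isExhaustion`, and `F` exists because the
projection of `D` is a club set and not a direction. For (a), `N` is a surface with real fibers over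
a Suslin tree, in which a shear pushes splitting branches infinitely far apart. Countability of
antichains (`LeveledSuslinTree.exists_cofinal`) gives `ω₁`-compactness. Countability of chains
(`LeveledSuslinTree.exists_split`) gives `F`. -/

instance : NoMaxOrder Omega1 :=
  ⟨fun a => (exists_gt_of_countable (countable_singleton a)).imp fun _ h => h a rfl⟩

instance : Nonempty Omega1 :=
  ⟨(exists_gt_of_countable (r := ∅) countable_empty).choose⟩

theorem countable_Iio_omega1 (β : Omega1) : (Iio β).Countable := by
  have h : ∀ o : Ordinal.{0}, o < Ordinal.omega 1 → o.card ≤ ℵ₀ := fun o ho => by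
    rwa [← Cardinal.ord_aleph, Cardinal.lt_ord, ← Cardinal.succ_aleph0,
      Order.lt_succ_iff] at ho
  have hc : (Iio (β.toOrd : Ordinal.{0})).Countable := by
    rw [← Cardinal.le_aleph0_iff_set_countable, Cardinal.mk_Iio_ordinal]
    exact Cardinal.lift_le_aleph0.2 (h _ (mem_Iio.1 β.toOrd.2))
  exact (hc.preimage (f := fun γ : Omega1 => (γ.toOrd : Ordinal.{0}))
    (Subtype.val_injective.comp Ordinal.ToType.mk.symm.injective)).mono
    fun γ hγ => Ordinal.ToType.mk.symm.lt_iff_lt.2 hγ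

theorem not_countable_omega1 : ¬ Countable Omega1 := fun _ => by
  obtain ⟨β, hβ⟩ := exists_gt_of_countable (r := univ) countable_univ
  exact lt_irrefl β (hβ β trivial)

theorem countable_Iic_omega1 (β : Omega1) : (Iic β).Countable := by
  rw [← Iio_union_right]
  exact (countable_Iio_omega1 β).union (countable_singleton β)

/-! ### The order of the long ray -/

namespace LongRay

/-- The point `(β, θ)` of the long ray. -/
def mk (β : Omega1) (θ : Ico (0 : ℝ) 1) : LongRay := toLex (β, θ)

/-- The ordinal part of a point of the long ray. -/
def fst (a : LongRay) : Omega1 := (ofLex (show Omega1 ×ₗ Ico (0 : ℝ) 1 from a)).1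

/-- The fractional part of a point of the long ray. -/
def snd (a : LongRay) : Ico (0 : ℝ) 1 := (ofLex (show Omega1 ×ₗ Ico (0 : ℝ) 1 from a)).2

/-- The embedding of the countable ordinals into the long ray. -/
def ord (β : Omega1) : LongRay := mk β ⟨0, by simp⟩

@[simp] theorem fst_mk (β θ) : (mk β θ).fst = β := rfl
@[simp] theorem snd_mk (β θ) : (mk β θ).snd = θ := rfl
@[simp] theorem fst_ord (β) : (ord β).fst = β := rfl
@[simp] theorem snd_ord (β) : ((ord β).snd : ℝ) = 0 := rfl

theorem lt_iff {a b : LongRay} : a < b ↔ a.fst < b.fst ∨ a.fst = b.fst ∧ (a.snd : ℝ) < b.snd :=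
  Prod.Lex.lt_iff

theorem le_iff {a b : LongRay} : a ≤ b ↔ a.fst < b.fst ∨ a.fst = b.fst ∧ (a.snd : ℝ) ≤ b.snd :=
  Prod.Lex.le_iff

theorem ext {a b : LongRay} (h : a.fst = b.fst) (h' : (a.snd : ℝ) = b.snd) : a = b :=
  le_antisymm (le_iff.2 (Or.inr ⟨h, h'.le⟩)) (le_iff.2 (Or.inr ⟨h.symm, h'.ge⟩))

theorem snd_nonneg (a : LongRay) : 0 ≤ (a.snd : ℝ) := a.snd.2.1

theorem snd_lt_one (a : LongRay) : (a.snd : ℝ) < 1 := a.snd.2.2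

theorem ord_le_iff {β : Omega1} {a : LongRay} : ord β ≤ a ↔ β ≤ a.fst := by
  rw [le_iff, fst_ord, snd_ord, and_iff_left a.snd_nonneg, le_iff_lt_or_eq]

theorem lt_ord_iff {β : Omega1} {a : LongRay} : a < ord β ↔ a.fst < β := by
  rw [← not_le, ord_le_iff, not_le]

theorem ord_lt_ord {β γ : Omega1} : ord β < ord γ ↔ β < γ := lt_ord_iff

theorem fst_mono {a b : LongRay} (h : a ≤ b) : a.fst ≤ b.fst := by
  rcases le_iff.1 h with h | h
  exacts [h.le, h.1.le]

theorem lt_ord_succ (a : LongRay) : a < ord (Order.succ a.fst) :=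
  lt_ord_iff.2 (Order.lt_succ _)

instance : NoMaxOrder LongRay := ⟨fun a => ⟨_, lt_ord_succ a⟩⟩

instance : Nonempty LongRay := ⟨ord (Classical.arbitrary _)⟩

theorem bddAbove_of_countable {s : Set LongRay} (hs : s.Countable) : BddAbove s := by
  obtain ⟨β, hβ⟩ := exists_gt_of_countable (hs.image fst)
  exact ⟨ord β, fun a ha => (lt_ord_iff.2 (hβ _ (mem_image_of_mem _ ha))).le⟩

instance : DenselyOrdered LongRay where
  dense a b h := by
    rcases lt_iff.1 h with h | ⟨h, h'⟩
    · have := a.snd_lt_one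
      have := a.snd_nonneg
      refine ⟨mk a.fst ⟨(a.snd + 1) / 2, by constructor <;> linarith⟩, ?_, ?_⟩
      · exact lt_iff.2 (Or.inr ⟨rfl, by simp only [snd_mk]; linarith⟩)
      · exact lt_iff.2 (Or.inl h)
    · have := b.snd_lt_one
      have := a.snd_nonneg
      refine ⟨mk a.fst ⟨(a.snd + b.snd) / 2, by constructor <;> linarith⟩, ?_, ?_⟩
      · exact lt_iff.2 (Or.inr ⟨rfl, by simp only [snd_mk]; linarith⟩)
      · exact lt_iff.2 (Or.inr ⟨h, by simp only [snd_mk]; linarith⟩)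

/-- Take the least ordinal part `β`, then the infimum of the fractional parts over `β`. It stays
below `1` because it is bounded by the fractional part of an element of `s`. -/
theorem exists_isGLB {s : Set LongRay} (hs : s.Nonempty) : ∃ a, IsGLB s a := by
  obtain ⟨β, ⟨x, hxs, hxβ⟩, hβ⟩ : ∃ β ∈ fst '' s, ∀ γ ∈ fst '' s, β ≤ γ :=
    ⟨wellFounded_lt.min _ (hs.image _), wellFounded_lt.min_mem _ _,
      fun γ hγ => WellFounded.min_le _ hγ⟩
  set R : Set ℝ := {r | ∃ b ∈ s, b.fst = β ∧ (b.snd : ℝ) = r} with hR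
  have hxR : (x.snd : ℝ) ∈ R := ⟨x, hxs, hxβ, rfl⟩
  have hbdd : BddBelow R := ⟨0, by rintro _ ⟨b, -, -, rfl⟩; exact b.snd_nonneg⟩
  have h0 : 0 ≤ sInf R := le_csInf ⟨_, hxR⟩ (by rintro _ ⟨b, -, -, rfl⟩; exact b.snd_nonneg)
  have h1 : sInf R < 1 := (csInf_le hbdd hxR).trans_lt x.snd_lt_one
  refine ⟨mk β ⟨sInf R, h0, h1⟩, fun b hb => ?_, fun c hc => ?_⟩
  · rcases (hβ _ (mem_image_of_mem _ hb)).lt_or_eq with h | h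
    · exact le_iff.2 (Or.inl h)
    · exact le_iff.2 (Or.inr ⟨h, csInf_le hbdd ⟨b, hb, h.symm, rfl⟩⟩)
  · have hcx := fst_mono (hc hxs)
    rw [hxβ] at hcx
    rcases hcx.lt_or_eq with h | h
    · exact le_iff.2 (Or.inl h)
    · refine le_iff.2 (Or.inr ⟨h, le_csInf ⟨_, hxR⟩ ?_⟩)
      rintro _ ⟨b, hb, hbβ, rfl⟩
      rcases le_iff.1 (hc hb) with h' | h'
      · exact absurd h' (by rw [h, hbβ]; exact lt_irrefl _)
      · exact h'.2

noncomputable instance : OrderBot LongRay where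
  bot := (exists_isGLB (univ_nonempty (α := LongRay))).choose
  bot_le a := (exists_isGLB (univ_nonempty (α := LongRay))).choose_spec.1 (mem_univ a)

theorem exists_isLUB {s : Set LongRay} (hs : BddAbove s) : ∃ a, IsLUB s a := by
  obtain ⟨a, ha⟩ := exists_isGLB (s := upperBounds s) hs
  exact ⟨a, isGLB_upperBounds.1 ha⟩

open Classical in
noncomputable instance : ConditionallyCompleteLinearOrderBot LongRay where
  __ := (inferInstance : LinearOrder LongRay)
  __ := (LinearOrder.toLattice : Lattice LongRay)
  __ := (inferInstance : OrderBot LongRay)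
  sSup s := if h : BddAbove s then (exists_isLUB h).choose else ⊥
  sInf s := if h : s.Nonempty then (exists_isGLB h).choose else ⊥
  isLUB_csSup s _ h := by
    simpa only [h, dif_pos] using (exists_isLUB h).choose_spec
  isGLB_csInf s h _ := by
    simpa only [h, dif_pos] using (exists_isGLB h).choose_spec
  csSup_of_not_bddAbove s h := by
    rw [dif_neg h, dif_pos bddAbove_empty]
    exact (isLUB_empty.unique (exists_isLUB bddAbove_empty).choose_spec)
  csInf_of_not_bddBelow s h := absurd (OrderBot.bddBelow s) h
  csSup_empty := by
    rw [dif_pos bddAbove_empty]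
    exact ((exists_isLUB bddAbove_empty).choose_spec.unique isLUB_empty)

theorem exists_ord_gt (a : LongRay) : ∃ α, a < ord α := ⟨_, lt_ord_succ a⟩

/-! ### Coordinates on initial segments -/

open Classical in
/-- The function that increases from `0` to `1` between `γ` and its successor and is constant
elsewhere. -/
noncomputable def step (γ : Omega1) (a : LongRay) : ℝ :=
  if a.fst < γ then 0 else if a.fst = γ then a.snd else 1

theorem step_of_le {γ : Omega1} {a : LongRay} (h : a ≤ ord γ) : step γ a = 0 := by
  rcases lt_or_eq_of_le h with h | rfl
  · rw [step, if_pos (lt_ord_iff.1 h)]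
  · simp [step]

theorem step_of_fst_lt {γ : Omega1} {a : LongRay} (h : a.fst < γ) : step γ a = 0 := if_pos h

theorem step_of_fst_eq {γ : Omega1} {a : LongRay} (h : a.fst = γ) : step γ a = a.snd := by
  rw [step, if_neg h.not_lt, if_pos h]

theorem step_of_lt_fst {γ : Omega1} {a : LongRay} (h : γ < a.fst) : step γ a = 1 := by
  rw [step, if_neg h.not_gt, if_neg h.ne']

theorem step_mem (γ : Omega1) (a : LongRay) : step γ a ∈ Icc (0 : ℝ) 1 := by
  have := a.snd_nonneg
  have := a.snd_lt_one
  unfold step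
  split_ifs <;> constructor <;> linarith

theorem step_mono (γ : Omega1) : Monotone (step γ) := by
  intro a b hab
  rcases lt_trichotomy a.fst γ with h | h | h
  · rw [step_of_fst_lt h]; exact (step_mem γ b).1
  · rcases (h ▸ fst_mono hab : γ ≤ b.fst).lt_or_eq with h' | h'
    · rw [step_of_lt_fst h']; exact (step_mem γ a).2
    · rw [step_of_fst_eq h, step_of_fst_eq h'.symm]
      rcases le_iff.1 hab with h'' | h''
      · exact absurd h'' (by rw [h, h']; exact lt_irrefl _)
      · exact h''.2
  · rw [step_of_lt_fst h, step_of_lt_fst (h.trans_le (fst_mono hab))]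

/-- A monotone surjection between order topologies is continuous; the value `1` is attained at the
successor of `γ`. -/
theorem continuous_step (γ : Omega1) : Continuous (step γ) := by
  let s : LongRay → Icc (0 : ℝ) 1 := fun a => ⟨step γ a, step_mem γ a⟩
  have hs : Function.Surjective s := by
    rintro ⟨r, h0, h1⟩
    rcases h1.lt_or_eq with h | rfl
    · exact ⟨mk γ ⟨r, h0, h⟩, Subtype.ext (step_of_fst_eq rfl)⟩
    · exact ⟨ord (Order.succ γ), Subtype.ext (step_of_lt_fst (Order.lt_succ γ))⟩
  have hm : Monotone s := fun a b h => step_mono γ h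
  exact continuous_subtype_val.comp (hm.continuous_of_surjective hs)

theorem step_lt_step {a b : LongRay} (h : a < b) : step a.fst a < step a.fst b := by
  rw [step_of_fst_eq rfl]
  rcases lt_iff.1 h with h | h
  · rw [step_of_lt_fst h]; exact a.snd_lt_one
  · rw [step_of_fst_eq h.1.symm]; exact h.2

/-- Initial segments of the long ray embed into the real line. -/
theorem exists_strictMonoOn (α : Omega1) : ∃ φ : C(LongRay, ℝ), Monotone φ ∧ φ ⊥ = 0 ∧
    StrictMonoOn φ (Iic (ord α)) ∧ ∀ a, φ a = φ (min a (ord α)) := by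
  have : Countable (Iio α) := (countable_Iio_omega1 α).to_subtype
  have : Encodable (Iio α) := Encodable.ofCountable _
  -- Summable positive weights: `φ` is the weighted sum of the steps below `α`. For `a < b`, the
  -- step at `a.fst` makes the inequality strict.
  obtain ⟨w, hw, c, hc, -⟩ := posSumOfEncodable one_pos (Iio α)
  have hle : ∀ (γ : Iio α) (a : LongRay), ‖w γ * step γ a‖ ≤ w γ := fun γ a => by
    rw [norm_mul, Real.norm_of_nonneg (hw γ).le, Real.norm_of_nonneg (step_mem _ a).1]
    exact mul_le_of_le_one_right (hw γ).le (step_mem _ a).2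
  have hsum : ∀ a, Summable fun γ : Iio α => w γ * step γ a := fun a =>
    Summable.of_norm_bounded hc.summable fun γ => hle γ a
  have hterm : ∀ (γ : Iio α) {a b : LongRay}, a ≤ b → w γ * step γ a ≤ w γ * step γ b :=
    fun γ a b h => mul_le_mul_of_nonneg_left (step_mono _ h) (hw γ).le
  refine ⟨⟨fun a => ∑' γ : Iio α, w γ * step γ a, continuous_tsum
    (fun γ => continuous_const.mul (continuous_step _)) hc.summable hle⟩, ?_, ?_, ?_, ?_⟩
  · exact fun a b h => (hsum a).tsum_le_tsum (fun γ => hterm γ h) (hsum b)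
  · simp [step_of_le bot_le]
  · intro a ha b hb hab
    have ha' : a.fst < α := lt_ord_iff.1 (hab.trans_le hb)
    exact Summable.tsum_lt_tsum (i := ⟨a.fst, ha'⟩) (fun γ => hterm γ hab.le)
      (mul_lt_mul_of_pos_left (step_lt_step hab) (hw _)) (hsum a) (hsum b)
  · intro a
    refine tsum_congr fun γ => ?_
    rcases le_total a (ord α) with h | h
    · rw [min_eq_left h]
    · rw [min_eq_right h, step_of_lt_fst (a := ord α) γ.2,
        step_of_lt_fst (γ.2.trans_le (ord_le_iff.1 h))]

/-- A continuous coordinate on an initial segment of the long ray, with a continuous inverse. -/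
theorem exists_coordinate (α : Omega1) : ∃ (φ : C(LongRay, ℝ)) (ψ : C(ℝ, LongRay)), Monotone φ ∧
    φ ⊥ = 0 ∧ StrictMonoOn φ (Iic (ord α)) ∧ (∀ a, ψ (φ a) = min a (ord α)) ∧
    ∀ r ∈ Icc 0 (φ (ord α)), φ (ψ r) = r := by
  obtain ⟨φ, hφ, h0, hs, hmin⟩ := exists_strictMonoOn α
  have hs' : StrictMonoOn φ (Icc ⊥ (ord α)) := by rwa [Icc_bot]
  have himg : φ '' Icc ⊥ (ord α) = Icc 0 (φ (ord α)) := by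
    refine subset_antisymm ?_ ?_
    · rintro _ ⟨a, ha, rfl⟩
      exact ⟨h0 ▸ hφ bot_le, hφ ha.2⟩
    · rw [← h0]
      exact intermediate_value_Icc bot_le φ.continuous.continuousOn
  have hle : (0 : ℝ) ≤ φ (ord α) := h0 ▸ hφ bot_le
  let e := (hs'.orderIso φ _).trans (OrderIso.setCongr _ _ himg)
  have he : ∀ a, ((e a : Icc 0 (φ (ord α))) : ℝ) = φ a := fun a => rfl
  have : OrdConnected (Icc (⊥ : LongRay) (ord α)) := ordConnected_Icc
  let ψ : C(ℝ, LongRay) := ⟨fun r => (e.symm (projIcc 0 (φ (ord α)) hle r) : LongRay),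
    continuous_subtype_val.comp (e.symm.continuous.comp continuous_projIcc)⟩
  refine ⟨φ, ψ, hφ, h0, hs, fun a => ?_, fun r hr => ?_⟩
  · have hm : min a (ord α) ∈ Icc (⊥ : LongRay) (ord α) := ⟨bot_le, min_le_right _ _⟩
    have h1 : projIcc 0 (φ (ord α)) hle (φ a) = e ⟨_, hm⟩ := by
      rw [hmin a, projIcc_of_mem hle ⟨h0 ▸ hφ bot_le, hφ (min_le_right _ _)⟩]
      rfl
    change ((e.symm (projIcc 0 (φ (ord α)) hle (φ a)) : Icc ⊥ (ord α)) : LongRay) = _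
    rw [h1, e.symm_apply_apply]
  · change φ (e.symm (projIcc 0 (φ (ord α)) hle r) : LongRay) = r
    rw [← he, e.apply_symm_apply, projIcc_of_mem hle hr]

/-! ### Topology of the long ray -/

theorem tendsto_of_strictMono {z : ℕ → LongRay} (hz : StrictMono z) :
    ∃ b, (∀ n, z n < b) ∧ Filter.Tendsto z Filter.atTop (𝓝 b) := by
  have hb := bddAbove_of_countable (countable_range z)
  exact ⟨⨆ n, z n, fun n => (hz n.lt_succ_self).trans_le (le_ciSup hb _),
    tendsto_atTop_ciSup hz.monotone hb⟩

theorem exists_gt_mem {A : Set LongRay} (hA : ¬ BddAbove A) (b : LongRay) : ∃ a ∈ A, b < a := by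
  by_contra! h
  exact hA ⟨b, h⟩

/-- Closed unbounded subsets of the long ray meet. -/
theorem inter_nonempty {A B : Set LongRay} (hA : IsClosed A) (hB : IsClosed B)
    (hA' : ¬ BddAbove A) (hB' : ¬ BddAbove B) : (A ∩ B).Nonempty := by
  choose f hfA hf using exists_gt_mem hA'
  choose g hgB hg using exists_gt_mem hB'
  -- The interlaced sequence `z n < f (z n) < z (n + 1)` has one limit, approached from both `A` and
  -- `B`.
  let z : ℕ → LongRay := fun n => (g ∘ f)^[n] ⊥
  have hz : ∀ n, z (n + 1) = g (f (z n)) := fun n => Function.iterate_succ_apply' _ _ _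
  have hzm : StrictMono z := strictMono_nat_of_lt_succ fun n => by
    rw [hz]; exact (hf _).trans (hg _)
  obtain ⟨b, hb, hzb⟩ := tendsto_of_strictMono hzm
  have hzb' := hzb.comp (Filter.tendsto_add_atTop_nat 1)
  refine ⟨b, hA.mem_of_tendsto (b := Filter.atTop) (f := fun n => f (z n)) ?_
    (Filter.Eventually.of_forall fun n => hfA _), hB.mem_of_tendsto hzb'
    (Filter.Eventually.of_forall fun n => ?_)⟩
  · refine tendsto_of_tendsto_of_tendsto_of_le_of_le hzb hzb' (fun n => (hf _).le) fun n => ?_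
    simp only [Function.comp_apply, hz]
    exact (hg _).le
  · simp only [Function.comp_apply, hz]
    exact hgB _

/-- A continuous self-map of the long ray that is bounded on a closed unbounded set is bounded. -/
theorem bddAbove_range_of_bddAbove_image (G : C(LongRay, LongRay)) {A : Set LongRay}
    (hA' : ¬ BddAbove A) (h : BddAbove (G '' A)) : BddAbove (range G) := by
  obtain ⟨b, hb⟩ := h
  obtain ⟨b', hbb'⟩ := exists_gt b
  by_contra hG
  -- Otherwise `G < b'` beyond some `c`, while `G` is bounded on the compact segment up to `c`.
  have hunb : ¬ BddAbove (G ⁻¹' Ici b') := by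
    rintro ⟨c, hc⟩
    obtain ⟨d, hd⟩ := (isCompact_Icc (a := ⊥) (b := c)).bddAbove_image G.continuous.continuousOn
    refine hG ⟨max b' d, ?_⟩
    rintro _ ⟨a, rfl⟩
    by_contra! h
    exact h.not_ge ((hd (mem_image_of_mem _ ⟨bot_le, hc ((le_max_left _ _).trans h.le)⟩)).trans
      (le_max_right _ _))
  obtain ⟨a, ha, ha'⟩ := inter_nonempty (isClosed_Iic.preimage G.continuous)
    (isClosed_Ici.preimage G.continuous)
    (fun h' => hA' (h'.mono (t := G ⁻¹' Iic b) fun x hx => hb (mem_image_of_mem _ hx))) hunb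
  exact (hbb'.trans_le (show b' ≤ G a from ha')).not_ge ha

end LongRay

/-! ### Locally Euclidean spaces -/

/-- Each point lies in the domain of a chart with values in `ℝⁿ`. -/
def IsLocallyEuclidean (n : ℕ) (X : Type*) [TopologicalSpace X] : Prop :=
  ∀ x : X, ∃ e : OpenPartialHomeomorph X (EuclideanSpace ℝ (Fin n)), x ∈ e.source

namespace IsLocallyEuclidean

variable {n : ℕ} {X Y : Type*} [TopologicalSpace X] [TopologicalSpace Y]

theorem exists_homeomorph (h : IsLocallyEuclidean n X) (x : X) :
    ∃ U : Set X, IsOpen U ∧ x ∈ U ∧ Nonempty (U ≃ₜ EuclideanSpace ℝ (Fin n)) := by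
  obtain ⟨e, hx⟩ := h x
  obtain ⟨r, hr, hball⟩ := Metric.isOpen_iff.1 e.open_target _ (e.map_source hx)
  let f := (OpenPartialHomeomorph.univBall (e x) r).trans e.symm
  have hf : f.source = univ := by
    refine eq_univ_of_forall fun y => ?_
    simp only [f, OpenPartialHomeomorph.trans_source, OpenPartialHomeomorph.univBall_source,
      univ_inter, mem_preimage, OpenPartialHomeomorph.symm_source]
    refine hball ?_
    rw [← OpenPartialHomeomorph.univBall_target (e x) hr]
    exact OpenPartialHomeomorph.map_source _ (by simp)
  have hemb := f.isOpenEmbedding hf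
  refine ⟨range f, hemb.isOpen_range, ⟨0, ?_⟩, ⟨hemb.toIsEmbedding.toHomeomorph.symm⟩⟩
  simp [f, e.left_inv hx]

theorem of_charts (h : IsLocallyEuclidean n Y)
    (hX : ∀ x : X, ∃ e : OpenPartialHomeomorph X Y, x ∈ e.source) : IsLocallyEuclidean n X := by
  intro x
  obtain ⟨e, he⟩ := hX x
  obtain ⟨c, hc⟩ := h (e x)
  exact ⟨e.trans c, by simp [he, hc]⟩

theorem prod_real (h : IsLocallyEuclidean n X) : IsLocallyEuclidean (n + 1) (X × ℝ) := by
  rintro ⟨x, r⟩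
  obtain ⟨c, hc⟩ := h x
  have hfin : Module.finrank ℝ (EuclideanSpace ℝ (Fin n) × ℝ)
      = Module.finrank ℝ (EuclideanSpace ℝ (Fin (n + 1))) := by simp
  let L := (ContinuousLinearEquiv.ofFinrankEq hfin).toHomeomorph
  exact ⟨(c.prod (OpenPartialHomeomorph.refl ℝ)).trans L.toOpenPartialHomeomorph, by simp [hc]⟩

theorem firstCountableTopology (h : IsLocallyEuclidean n X) : FirstCountableTopology X := by
  refine ⟨fun x => ?_⟩
  obtain ⟨e, hx⟩ := h x
  rw [← e.symm_map_nhds_eq hx]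
  infer_instance

theorem locallyCompactSpace (h : IsLocallyEuclidean n X) : LocallyCompactSpace X := by
  choose c hc using h
  let _ : ChartedSpace (EuclideanSpace ℝ (Fin n)) X :=
    { atlas := univ
      chartAt := c
      mem_chart_source := hc
      chart_mem_atlas := fun _ => trivial }
  exact ChartedSpace.locallyCompactSpace (EuclideanSpace ℝ (Fin n)) X

theorem of_isTopManifold (h : IsTopManifold n X) : IsLocallyEuclidean n X := by
  intro x
  obtain ⟨U, hU, hx, ⟨e⟩⟩ := h.locally_euclidean x
  have : Nonempty (EuclideanSpace ℝ (Fin n)) := inferInstance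
  refine ⟨((hU.isOpenEmbedding_subtypeVal.comp
    e.symm.isOpenEmbedding).toOpenPartialHomeomorph _).symm, ?_⟩
  simp only [OpenPartialHomeomorph.symm_source, IsOpenEmbedding.toOpenPartialHomeomorph_target]
  exact ⟨e ⟨x, hx⟩, by simp⟩

end IsLocallyEuclidean

/-! ### Exhaustion functions -/

section Exhaustion

variable {X : Type*} [TopologicalSpace X]

/-- A map to the long ray all of whose sublevel sets are Lindelöf. -/
def IsExhaustion (r : C(X, LongRay)) : Prop := ∀ a, IsLindelof {x | r x ≤ a}

variable {r : C(X, LongRay)}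

theorem IsExhaustion.isTypeISeq (hr : IsExhaustion r) :
    IsTypeISeq fun α => {x | r x < LongRay.ord α} := by
  have hcl : ∀ α, closure {x | r x < LongRay.ord α} ⊆ {x | r x ≤ LongRay.ord α} := fun α =>
    closure_minimal (fun x hx => le_of_lt (show r x < LongRay.ord α from hx))
      (isClosed_Iic.preimage r.continuous)
  refine ⟨fun α => isOpen_Iio.preimage r.continuous, fun α => ?_, fun α β h => ?_, ?_⟩
  · exact (hr _).of_isClosed_subset isClosed_closure (hcl α)
  · exact (hcl α).trans fun x hx => lt_of_le_of_lt hx (LongRay.ord_lt_ord.2 h)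
  · exact eq_univ_of_forall fun x => mem_iUnion.2 (LongRay.exists_ord_gt (r x))

theorem IsExhaustion.isBounded_iff (hr : IsExhaustion r) {A : Set X} :
    IsBounded A ↔ BddAbove (r '' A) := by
  rw [Directions.isBounded_iff hr.isTypeISeq]
  constructor
  · rintro ⟨α, h⟩
    exact ⟨LongRay.ord α, forall_mem_image.2 fun x hx => (h hx).le⟩
  · rintro ⟨a, h⟩
    exact ⟨_, fun x hx => (h (mem_image_of_mem _ hx)).trans_lt (LongRay.lt_ord_succ a)⟩

theorem IsExhaustion.isTypeI (hr : IsExhaustion r) (h : ¬ BddAbove (range r)) : IsTypeI X := by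
  refine ⟨⟨_, hr.isTypeISeq⟩, fun hX => h ?_⟩
  obtain ⟨s, hs, hcov⟩ := hX.isLindelof_univ.elim_countable_subcover _ hr.isTypeISeq.isOpen
    hr.isTypeISeq.iUnion_eq.ge
  obtain ⟨β, hβ⟩ := exists_gt_of_countable hs
  refine ⟨LongRay.ord β, forall_mem_range.2 fun x => ?_⟩
  obtain ⟨i, hi, hx⟩ := mem_iUnion₂.1 (hcov (mem_univ x))
  exact (lt_trans hx (LongRay.ord_lt_ord.2 (hβ i hi))).le

/-- The traces of closed unbounded sets on a properly embedded long ray are directions. -/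
theorem IsExhaustion.isDirection [T2Space X] (hr : IsExhaustion r) {j : C(LongRay, X)}
    (hj : ∀ z, z ≤ r (j z)) (hj' : ∀ z, j (r (j z)) = j z) {C : Set X} (hC : IsClosed C)
    (hC' : ¬ BddAbove (j ⁻¹' C)) : IsDirection (C ∩ range j) := by
  -- `j ∘ r` fixes exactly the points of the range, which is therefore closed in a Hausdorff space.
  have hrange : range j = {x | j (r x) = x} :=
    subset_antisymm (range_subset_iff.2 hj') fun x hx => ⟨_, hx⟩
  have hcl : IsClosed (range j) := by
    rw [hrange]
    exact isClosed_eq (by fun_prop) continuous_id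
  have hpre : ∀ {A : Set X}, A ⊆ range j → ¬ IsBounded A → ¬ BddAbove (j ⁻¹' A) := by
    rintro A hA hA' ⟨b, hb⟩
    refine hA' (hr.isBounded_iff.2 ⟨b, forall_mem_image.2 fun x hx => hb ?_⟩)
    rw [hrange] at hA
    rwa [mem_preimage, hA hx]
  refine ⟨⟨hC.inter hcl, fun h => hC' ?_⟩, fun C' hC' hclub => ⟨fun f hf hf' => hf ?_, ?_⟩⟩
  · obtain ⟨b, hb⟩ := hr.isBounded_iff.1 h
    exact ⟨b, fun z hz => (hj z).trans (hb ⟨j z, ⟨hz, z, rfl⟩, rfl⟩)⟩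
  · exact hf'.mono (image_mono hC')
  · intro f hf hf'
    refine hf ?_
    -- Pulling back along `j` reduces the claim to a self-map of the long ray that is bounded on an
    -- unbounded closed set.
    have h := LongRay.bddAbove_range_of_bddAbove_image (f.comp j)
      (hpre (hC'.trans inter_subset_right) hclub.2) (hf'.mono ?_)
    · refine h.mono ?_
      rintro _ ⟨x, ⟨-, z, rfl⟩, rfl⟩
      exact ⟨z, rfl⟩
    · rintro _ ⟨z, hz, rfl⟩
      exact ⟨j z, hz, rfl⟩

end Exhaustion

/-! ### `ω₁`-compactness -/

section Omega1Compact

variable {X : Type*} [TopologicalSpace X]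

/-- Otherwise each point has a neighborhood meeting `A` in finitely many points. Removing those
other than the point itself shows that `A` is closed and discrete. -/
theorem IsOmega1Compact.exists_infinite_inter [T1Space X] (h : IsOmega1Compact X) {A : Set X}
    (hA : ¬ A.Countable) : ∃ x, ∀ W ∈ 𝓝 x, (W ∩ A).Infinite := by
  by_contra! hx
  have hacc : ∀ x, ∃ W ∈ 𝓝 x, W ∩ A ⊆ {x} := fun x => by
    obtain ⟨W, hW, hfin⟩ := hx x
    refine ⟨W ∩ ((W ∩ A) \ {x})ᶜ, Filter.inter_mem hW
      ((hfin.subset sdiff_subset).isClosed.isOpen_compl.mem_nhds (by simp)), ?_⟩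
    rintro y ⟨⟨hyW, hy⟩, hyA⟩
    by_contra hne
    exact hy ⟨⟨hyW, hyA⟩, hne⟩
  refine hA (h A (isClosed_of_closure_subset fun x hxA => ?_)
    (isDiscrete_iff_forall_mem_exists_isOpen.2 fun x hxA => ?_))
  · obtain ⟨W, hW, hWA⟩ := hacc x
    obtain ⟨y, hyW, hyA⟩ := mem_closure_iff_nhds.1 hxA W hW
    rwa [← show y = x from hWA ⟨hyW, hyA⟩]
  · obtain ⟨W, hW, hWA⟩ := hacc x
    obtain ⟨U, hUW, hU, hxU⟩ := mem_nhds_iff.1 hW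
    refine ⟨U, hU, subset_antisymm ((inter_subset_inter_left _ hUW).trans hWA) ?_⟩
    rintro _ rfl
    exact ⟨hxU, hxA⟩

theorem not_forall_infinite_inter {D : Set X} (hD : IsClosed D) (hD' : IsDiscrete D) (x : X) :
    ¬ ∀ W ∈ 𝓝 x, (W ∩ D).Infinite := by
  intro h
  have hx : x ∈ D := by
    by_contra hx
    simpa using h _ (hD.isOpen_compl.mem_nhds hx)
  obtain ⟨U, hU, hUD⟩ := isDiscrete_iff_forall_mem_exists_isOpen.1 hD' x hx
  have := h U (hU.mem_nhds (hUD.ge rfl).1)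
  rw [hUD] at this
  exact this (finite_singleton x)

/-- A countably infinite subset of a closed discrete set would have a compact discrete, hence
finite, closure. -/
theorem IsOmegaBounded.isOmega1Compact [T1Space X] (h : IsOmegaBounded X) : IsOmega1Compact X := by
  intro D hD hD'
  by_contra hc
  have hinf : D.Infinite := fun hf => hc hf.countable
  obtain ⟨A, hAD, hA, hAc⟩ := hinf.exists_subset_countable_infinite
  have hcl : closure A ⊆ D := closure_minimal hAD hD
  exact hAc (((h A hA).finite (hD'.mono hcl)).subset subset_closure)

end Omega1Compact

/-! ### Lindelöf products and choice along `ω₁` -/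

theorem _root_.IsLindelof.prod_isCompact {X Y : Type*} [TopologicalSpace X] [TopologicalSpace Y]
    {K : Set X} {C : Set Y} (hK : IsLindelof K) (hC : IsCompact C) : IsLindelof (K ×ˢ C) := by
  refine isLindelof_of_countable_subcover fun {ι} W hW hcov => ?_
  have hx : ∀ x, ∃ t : Set ι, ∃ u : Set X, t.Countable ∧ (x ∈ K → u ∈ 𝓝 x) ∧
      u ×ˢ C ⊆ ⋃ i ∈ t, W i := by
    intro x
    by_cases hxK : x ∈ K
    · have hsub : ({x} : Set X) ×ˢ C ⊆ ⋃ i, W i :=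
        (prod_mono_left (singleton_subset_iff.2 hxK)).trans hcov
      obtain ⟨t, ht, htW⟩ := (isCompact_singleton.prod hC).isLindelof.elim_countable_subcover
        W hW hsub
      obtain ⟨u, v, hu, -, hxu, hCv, huv⟩ := generalized_tube_lemma isCompact_singleton hC
        (isOpen_biUnion fun i _ => hW i) htW
      exact ⟨t, u, ht, fun _ => hu.mem_nhds (hxu rfl), (prod_mono_right hCv).trans huv⟩
    · exact ⟨∅, ∅, countable_empty, fun h => absurd h hxK, by simp⟩
  choose t u ht hu htu using hx
  obtain ⟨s, hs, -, hKs⟩ := hK.elim_nhds_subcover u hu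
  refine ⟨⋃ x ∈ s, t x, hs.biUnion fun x _ => ht x, ?_⟩
  rintro ⟨x, y⟩ ⟨hx, hy⟩
  obtain ⟨x', hx', hxu⟩ := mem_iUnion₂.1 (hKs hx)
  obtain ⟨i, hi, hxy⟩ := mem_iUnion₂.1 (htu x' (⟨hxu, hy⟩ : (x, y) ∈ u x' ×ˢ C))
  exact mem_iUnion₂.2 ⟨i, mem_iUnion₂.2 ⟨x', hx', hi⟩, hxy⟩

/-- Recursive choice of `ω₁` many elements such that a first function dominates all earlier values
of a second one. -/
theorem exists_omega1_sequence {X : Type*} {C : Set X} (g Φ : X → LongRay)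
    (h : ∀ b, ∃ p ∈ C, b < g p) :
    ∃ p : Omega1 → X, (∀ ξ, p ξ ∈ C) ∧ ∀ η ξ, η < ξ → Φ (p η) < g (p ξ) := by
  choose f hfC hf using h
  -- Only countably many terms precede `ξ`, so their `Φ`-values have a supremum in the long ray.
  let p : Omega1 → X := wellFounded_lt.fix fun ξ q => f (⨆ η : Iio ξ, Φ (q η.1 η.2))
  have hp : ∀ ξ, p ξ = f (⨆ η : Iio ξ, Φ (p η)) := fun ξ => wellFounded_lt.fix_eq _ ξ
  refine ⟨p, fun ξ => by rw [hp]; exact hfC _, fun η ξ h => ?_⟩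
  have : Countable (Iio ξ) := (countable_Iio_omega1 ξ).to_subtype
  rw [hp ξ]
  exact (le_ciSup (f := fun η : Iio ξ => Φ (p η))
    (LongRay.bddAbove_of_countable (countable_range _)) ⟨η, h⟩).trans_lt (hf _)

/-! ### Doubles

For a map `g : N → 𝕃_{≥0}`, two copies of `{(x, y) | g x ≤ y}` glued along `{(x, y) | g x = y}`. -/

/-- The double of the set above the graph of `g`. -/
abbrev Double {N : Type*} [TopologicalSpace N] (g : C(N, LongRay)) : Type _ :=
  {p : N × LongRay × LongRay // min p.2.1 p.2.2 = g p.1}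

namespace Double

variable {N : Type*} [TopologicalSpace N] {g : C(N, LongRay)}

/-- The projection to the base. -/
noncomputable def base : C(Double g, N) := ⟨fun p => p.1.1, by fun_prop⟩

/-- The first coordinate in the long ray. -/
noncomputable def left : C(Double g, LongRay) := ⟨fun p => p.1.2.1, by fun_prop⟩

/-- The second coordinate in the long ray. -/
noncomputable def right : C(Double g, LongRay) := ⟨fun p => p.1.2.2, by fun_prop⟩

/-- The map `g` on the base. -/
noncomputable def height : C(Double g, LongRay) := g.comp base

/-- The larger one of the two coordinates in the long ray. -/
noncomputable def radius : C(Double g, LongRay) := ⟨fun p => max (left p) (right p), by fun_prop⟩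

theorem min_eq (p : Double g) : min (left p) (right p) = g (base p) := p.2

theorem radius_apply (p : Double g) : radius p = max (left p) (right p) := rfl

theorem height_le_left (p : Double g) : height p ≤ left p := (min_eq p).ge.trans (min_le_left _ _)

theorem height_le_right (p : Double g) : height p ≤ right p :=
  (min_eq p).ge.trans (min_le_right _ _)

theorem height_le_radius (p : Double g) : height p ≤ radius p :=
  (height_le_left p).trans (le_max_left _ _)

theorem ext {p q : Double g} (h : base p = base q) (hl : left p = left q)
    (hr : right p = right q) : p = q :=
  Subtype.ext (Prod.ext h (Prod.ext hl hr))

/-- The exchange of the two copies. -/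
noncomputable def swap : C(Double g, Double g) :=
  ⟨fun p => ⟨(p.1.1, p.1.2.2, p.1.2.1), by rw [min_comm]; exact p.2⟩, by fun_prop⟩

theorem swap_swap (p : Double g) : swap (swap p) = p := rfl

/-- The vertical ray above a point of the base. -/
noncomputable def line (x : N) : C(LongRay, Double g) :=
  ⟨fun z => ⟨(x, g x, max z (g x)), min_eq_left (le_max_right _ _)⟩, by fun_prop⟩

/-- The diagonal. -/
noncomputable def diag : C(N, Double g) := ⟨fun x => ⟨(x, g x, g x), min_self _⟩, by fun_prop⟩

@[simp] theorem right_line (x : N) (z) : right (line (g := g) x z) = max z (g x) := rfl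

theorem radius_swap (p : Double g) : radius (swap p) = radius p := max_comm _ _

theorem radius_line (x : N) (z) : radius (line (g := g) x z) = max z (g x) :=
  max_eq_right (le_max_right _ _)

theorem line_radius_line (x : N) (z) : line x (radius (line (g := g) x z)) = line (g := g) x z := by
  refine ext rfl rfl ?_
  simp [radius_line]

theorem line_right {p : Double g} (h : left p ≤ right p) : line (base p) (right p) = p := by
  have h' := min_eq p
  rw [min_eq_left h] at h'
  refine ext rfl h'.symm ?_
  rw [right_line, ← h', max_eq_left h]

theorem isClosedEmbedding_val :
    IsClosedEmbedding (Subtype.val : Double g → N × LongRay × LongRay) :=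
  (isClosed_eq (by fun_prop) (by fun_prop)).isClosedEmbedding_subtypeVal

theorem setOf_radius_le (a : LongRay) : {p : Double g | radius p ≤ a} =
    Subtype.val ⁻¹' ({x | g x ≤ a} ×ˢ (Icc ⊥ a ×ˢ Icc ⊥ a)) := by
  ext p
  have h := height_le_radius p
  constructor
  · intro hp
    exact ⟨h.trans hp, ⟨bot_le, (le_max_left _ _).trans hp⟩, ⟨bot_le, (le_max_right _ _).trans hp⟩⟩
  · rintro ⟨-, h1, h2⟩
    exact max_le h1.2 h2.2

theorem isExhaustion_radius (hg : IsExhaustion g) : IsExhaustion (radius (g := g)) := fun a => by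
  rw [setOf_radius_le]
  exact isClosedEmbedding_val.isLindelof_preimage
    ((hg a).prod_isCompact (isCompact_Icc.prod isCompact_Icc))

theorem isOmegaBounded [T2Space N] (h : IsOmegaBounded N) : IsOmegaBounded (Double g) := by
  intro A hA
  obtain ⟨a, ha⟩ := LongRay.bddAbove_of_countable (hA.image radius)
  have hK := (isClosedEmbedding_val (g := g)).isCompact_preimage
    ((h _ (hA.image base)).prod ((isCompact_Icc (a := ⊥) (b := a)).prod
      (isCompact_Icc (a := ⊥) (b := a))))
  refine hK.of_isClosed_subset isClosed_closure (closure_minimal (fun p hp => ?_) hK.isClosed)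
  have h' : max (left p) (right p) ≤ a := ha (mem_image_of_mem _ hp)
  exact ⟨subset_closure (mem_image_of_mem _ hp), ⟨bot_le, (le_max_left _ _).trans h'⟩,
    ⟨bot_le, (le_max_right _ _).trans h'⟩⟩

/-! #### The manifold structure -/

/-- In a real coordinate `φ` of an initial segment beyond `p`, the difference of the two long ray
coordinates is free. Its sign names the sheet, and together with the base point it determines both
coordinates, as the smaller one is `g`. -/
theorem exists_chart (p : Double g) : ∃ e : OpenPartialHomeomorph (Double g) (N × ℝ),
    p ∈ e.source := by
  obtain ⟨α, hα⟩ := LongRay.exists_ord_gt (radius p)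
  obtain ⟨φ, ψ, hφ, h0, hs, hψ, hφψ⟩ := LongRay.exists_coordinate α
  set a := LongRay.ord α with ha
  have hlt : ∀ {b : LongRay}, φ b < φ a → b < a := fun h => hφ.reflect_lt h
  have hlt' : ∀ {b : LongRay}, b < a → φ b < φ a := fun h => hs h.le (mem_Iic.2 le_rfl) h
  have hgψ : ∀ x, max (g x) (ψ (φ (g x) + 0)) = g x := fun x => by
    rw [add_zero, hψ]
    exact max_eq_left (min_le_left _ _)
  have hmem : ∀ {q : N × ℝ}, φ (g q.1) + |q.2| < φ a → ∀ {t}, 0 ≤ t → t ≤ |q.2| →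
      φ (ψ (φ (g q.1) + t)) = φ (g q.1) + t := fun {q} h t h1 h2 =>
    hφψ _ ⟨add_nonneg (h0 ▸ hφ bot_le) h1, by linarith⟩
  refine ⟨{
    toFun := fun q => (base q, φ (left q) - φ (right q))
    -- The outer maxima keep the value in the double off the target as well, where `ψ ∘ φ` truncates
    -- at `a`.
    invFun := fun q => ⟨(q.1, max (g q.1) (ψ (φ (g q.1) + max q.2 0)),
      max (g q.1) (ψ (φ (g q.1) + max (-q.2) 0))), by
        rcases le_total 0 q.2 with h | h
        · simp only [max_eq_right (neg_nonpos.2 h), hgψ]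
          exact min_eq_right (le_max_left _ _)
        · simp only [max_eq_right h, hgψ]
          exact min_eq_left (le_max_left _ _)⟩
    source := {q | left q < a ∧ right q < a}
    target := {q | φ (g q.1) + |q.2| < φ a}
    map_source' := ?_
    map_target' := ?_
    left_inv' := ?_
    right_inv' := ?_
    open_source := (isOpen_Iio.preimage left.continuous).inter
      (isOpen_Iio.preimage right.continuous)
    open_target := isOpen_lt (by fun_prop) (by fun_prop)
    continuousOn_toFun := Continuous.continuousOn (by fun_prop)
    continuousOn_invFun := Continuous.continuousOn (by fun_prop) },
    (le_max_left _ _).trans_lt hα, (le_max_right _ _).trans_lt hα⟩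
  · rintro q ⟨hl, hr⟩
    change φ (g (base q)) + |φ (left q) - φ (right q)| < φ a
    rw [← min_eq]
    rcases le_total (left q) (right q) with h | h
    · rw [min_eq_left h, abs_of_nonpos (sub_nonpos.2 (hφ h))]
      linarith [hlt' hr]
    · rw [min_eq_right h, abs_of_nonneg (sub_nonneg.2 (hφ h))]
      linarith [hlt' hl]
  · rintro q hq
    have hq' : φ (g q.1) + |q.2| < φ a := hq
    have hg' : g q.1 < a := hlt (by linarith [abs_nonneg q.2])
    refine ⟨max_lt hg' (hlt ?_), max_lt hg' (hlt ?_)⟩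
    · rw [hmem hq' (le_max_right _ _) (max_le (le_abs_self _) (abs_nonneg _))]
      linarith [max_le (le_abs_self q.2) (abs_nonneg q.2)]
    · rw [hmem hq' (le_max_right _ _) (max_le (neg_le_abs _) (abs_nonneg _))]
      linarith [max_le (neg_le_abs q.2) (abs_nonneg q.2)]
  · rintro q ⟨hl, hr⟩
    have key : ∀ {b c : LongRay}, min b c = g (base q) → b < a → c < a →
        max (g (base q)) (ψ (φ (g (base q)) + max (φ b - φ c) 0)) = b := by
      intro b c h hb hc
      rcases le_total b c with hbc | hbc
      · rw [max_eq_right (sub_nonpos.2 (hφ hbc)), hgψ, ← h, min_eq_left hbc]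
      · rw [max_eq_left (sub_nonneg.2 (hφ hbc)), ← h, min_eq_right hbc, add_sub_cancel, hψ,
          min_eq_left hb.le, max_eq_right hbc]
    refine ext rfl (key (min_eq q) hl hr) ?_
    have := key ((min_comm _ _).trans (min_eq q)) hr hl
    rwa [← neg_sub] at this
  · rintro q hq
    have hq' : φ (g q.1) + |q.2| < φ a := hq
    refine Prod.ext rfl ?_
    change φ (max (g q.1) (ψ (φ (g q.1) + max q.2 0)))
      - φ (max (g q.1) (ψ (φ (g q.1) + max (-q.2) 0))) = q.2
    rw [hφ.map_max, hφ.map_max, hmem hq' (le_max_right _ _) (max_le (le_abs_self _) (abs_nonneg _)),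
      hmem hq' (le_max_right _ _) (max_le (neg_le_abs _) (abs_nonneg _)),
      max_eq_right (le_add_of_nonneg_right (le_max_right _ _)),
      max_eq_right (le_add_of_nonneg_right (le_max_right _ _)), add_sub_add_left_eq_sub]
    rcases le_total 0 q.2 with h | h
    · rw [max_eq_left h, max_eq_right (neg_nonpos.2 h), sub_zero]
    · rw [max_eq_right h, max_eq_left (neg_nonneg.2 h), zero_sub, neg_neg]

theorem isLocallyEuclidean {n : ℕ} (h : IsLocallyEuclidean n N) :
    IsLocallyEuclidean (n + 1) (Double g) :=
  h.prod_real.of_charts exists_chart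

/-- A vertical ray in its sheet joins each point to the diagonal, which is a continuous image of
`N`. -/
theorem connectedSpace [ConnectedSpace N] : ConnectedSpace (Double g) := by
  obtain ⟨x₀⟩ : Nonempty N := inferInstance
  have key : ∀ (p : Double g), ∃ t : Set (Double g), p ∈ t ∧ diag (base p) ∈ t ∧
      IsPreconnected t := by
    intro p
    rcases le_total (left p) (right p) with h | h
    · refine ⟨range (line (base p)), ⟨right p, line_right h⟩, ⟨g (base p), ?_⟩,
        isPreconnected_range (line _).continuous⟩
      exact ext rfl rfl (max_self _)
    · refine ⟨range (swap.comp (line (base p))), ⟨left p, ?_⟩, ⟨g (base p), ?_⟩,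
        isPreconnected_range (ContinuousMap.continuous _)⟩
      · exact congrArg swap (line_right (p := swap p) h)
      · exact ext rfl (max_self _) rfl
  refine { toNonempty := ⟨diag x₀⟩, isPreconnected_univ := ?_ }
  refine isPreconnected_of_forall (diag x₀) fun p _ => ?_
  obtain ⟨t, hp, hd, ht⟩ := key p
  exact ⟨t ∪ range diag, subset_univ _, Or.inr ⟨x₀, rfl⟩, Or.inl hp,
    ht.union (diag (base p)) hd ⟨_, rfl⟩ (isPreconnected_range diag.continuous)⟩

end Double

namespace Double

variable {N : Type*} [TopologicalSpace N] {g : C(N, LongRay)}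

/-! #### Accumulation points -/

theorem tendsto_iff {ι : Type*} {l : Filter ι} {p : ι → Double g} {q : Double g} :
    Filter.Tendsto p l (𝓝 q) ↔ Filter.Tendsto (fun i => base (p i)) l (𝓝 (base q)) ∧
      Filter.Tendsto (fun i => left (p i)) l (𝓝 (left q)) ∧
      Filter.Tendsto (fun i => right (p i)) l (𝓝 (right q)) := by
  rw [tendsto_subtype_rng, nhds_prod_eq, nhds_prod_eq, Filter.tendsto_prod_iff',
    Filter.tendsto_prod_iff']
  rfl

theorem exists_line_accumulation [FirstCountableTopology N] (hg : IsExhaustion g)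
    {A : Set (Double g)} {a : LongRay} (hA : ∀ p ∈ A, height p ≤ a)
    (hA' : ∀ p ∈ A, left p ≤ right p) (hub : ¬ BddAbove (right '' A)) :
    ∃ x, ∀ b, ∃ z, b < z ∧ ∀ W ∈ 𝓝 (line (g := g) x z), (W ∩ A).Infinite := by
  -- If each base point had a neighborhood over which `A` is bounded, countably many would cover the
  -- Lindelöf set `{g ≤ a}` and bound `A`.
  obtain ⟨x, hx⟩ : ∃ x, ∀ V ∈ 𝓝 x, ¬ BddAbove (right '' (A ∩ base ⁻¹' V)) := by
    by_contra! h
    choose V hV c hc using h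
    obtain ⟨t, ht, -, hcov⟩ := (hg a).elim_nhds_subcover V fun x _ => hV x
    obtain ⟨d, hd⟩ := LongRay.bddAbove_of_countable (ht.image c)
    refine hub ⟨d, forall_mem_image.2 fun p hp => ?_⟩
    obtain ⟨x, hxt, hpx⟩ := mem_iUnion₂.1 (hcov (hA p hp))
    exact (hc x (mem_image_of_mem _ ⟨hp, hpx⟩)).trans (hd (mem_image_of_mem _ hxt))
  refine ⟨x, fun b => ?_⟩
  obtain ⟨V, hV⟩ := (𝓝 x).exists_antitone_basis
  -- Points over shrinking neighborhoods of `x` with strictly increasing right coordinates converge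
  -- to a point of the ray over `x`; on this sheet the left coordinate equals the height.
  have hstep : ∀ (n : ℕ) (b : LongRay), ∃ p ∈ A, base p ∈ V n ∧ b < right p := fun n b => by
    obtain ⟨_, ⟨p, ⟨hp, hpV⟩, rfl⟩, hb⟩ := LongRay.exists_gt_mem (hx _ (hV.mem n)) b
    exact ⟨p, hp, hpV, hb⟩
  choose P hPA hPV hPb using hstep
  let p : ℕ → Double g := fun n => Nat.rec (P 0 b) (fun n q => P (n + 1) (right q)) n
  have hpA : ∀ n, p n ∈ A := fun n => by cases n <;> exact hPA _ _
  have hpV : ∀ n, base (p n) ∈ V n := fun n => by cases n <;> exact hPV _ _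
  have hmono : StrictMono fun n => right (p n) := strictMono_nat_of_lt_succ fun n => hPb _ _
  obtain ⟨z, hz, hlim⟩ := LongRay.tendsto_of_strictMono hmono
  have hbase : Filter.Tendsto (fun n => base (p n)) Filter.atTop (𝓝 x) := hV.tendsto hpV
  have hleft : Filter.Tendsto (fun n => left (p n)) Filter.atTop (𝓝 (g x)) := by
    refine ((g.continuous.tendsto x).comp hbase).congr fun n => ?_
    rw [Function.comp_apply, ← min_eq, min_eq_left (hA' _ (hpA n))]
  have hgz : g x ≤ z := le_of_tendsto_of_tendsto' hleft hlim fun n => hA' _ (hpA n)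
  have hp : Filter.Tendsto p Filter.atTop (𝓝 (line x z)) :=
    tendsto_iff.2 ⟨hbase, hleft, by rwa [right_line, max_eq_left hgz]⟩
  refine ⟨z, (hPb 0 b).trans (hz 0), fun W hW => ?_⟩
  obtain ⟨m, hm⟩ := Filter.eventually_atTop.1 (hp hW)
  have hinj : Function.Injective p := fun i j h => hmono.injective (congrArg right h)
  refine ((Set.Ici_infinite m).image hinj.injOn).mono ?_
  rintro _ ⟨n, hn, rfl⟩
  exact ⟨hm n hn, hpA n⟩

/-- One of the two sheets carries an unbounded part of `A`; the exchange of sheets reduces to the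
one with `left ≤ right`. -/
theorem exists_ray_accumulation [FirstCountableTopology N] (hg : IsExhaustion g)
    {A : Set (Double g)} {a : LongRay} (hA : ∀ p ∈ A, height p ≤ a)
    (hub : ¬ BddAbove (radius '' A)) :
    ∃ j : C(LongRay, Double g), (∀ z, z ≤ radius (j z)) ∧ (∀ z, j (radius (j z)) = j z) ∧
      ∀ b, ∃ z, b < z ∧ ∀ W ∈ 𝓝 (j z), (W ∩ A).Infinite := by
  by_cases h : BddAbove (right '' {p ∈ A | left p ≤ right p})
  · have h' : ¬ BddAbove (right '' (swap '' {p ∈ A | right p ≤ left p})) := by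
      rintro ⟨c, hc⟩
      obtain ⟨b, hb⟩ := h
      refine hub ⟨max b c, forall_mem_image.2 fun p hp => ?_⟩
      rcases le_total (left p) (right p) with h' | h'
      · rw [radius_apply, max_eq_right h']
        exact (hb (mem_image_of_mem _ ⟨hp, h'⟩)).trans (le_max_left _ _)
      · rw [radius_apply, max_eq_left h']
        exact (hc ⟨swap p, mem_image_of_mem _ ⟨hp, h'⟩, rfl⟩).trans (le_max_right _ _)
    obtain ⟨x, hx⟩ := exists_line_accumulation hg (a := a)
      (by rintro _ ⟨p, hp, rfl⟩; exact hA p hp.1) (by rintro _ ⟨p, hp, rfl⟩; exact hp.2) h'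
    refine ⟨swap.comp (line x), fun z => ?_, fun z => ?_, fun b => ?_⟩
    · rw [ContinuousMap.comp_apply, radius_swap, radius_line]
      exact le_max_left _ _
    · simp only [ContinuousMap.comp_apply, radius_swap, line_radius_line]
    · obtain ⟨z, hz, hW⟩ := hx b
      refine ⟨z, hz, fun W hW' => ?_⟩
      have := hW (swap ⁻¹' W) (swap.continuous.continuousAt.preimage_mem_nhds hW')
      refine (this.image (f := swap) fun p _ q _ hpq => ?_).mono ?_
      · rw [← swap_swap p, hpq, swap_swap]
      · rintro _ ⟨_, ⟨hpW, p, hp, rfl⟩, rfl⟩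
        exact ⟨hpW, hp.1⟩
  · obtain ⟨x, hx⟩ := exists_line_accumulation hg (fun p hp => hA p hp.1) (fun p hp => hp.2) h
    refine ⟨line x, fun z => ?_, line_radius_line x, fun b => ?_⟩
    · rw [radius_line]
      exact le_max_left _ _
    · obtain ⟨z, hz, hW⟩ := hx b
      exact ⟨z, hz, fun W hW' => (hW W hW').mono (inter_subset_inter_right _ (sep_subset _ _))⟩

/-- Order-convexity of `J` is the point: a coordinate squeezed between two heights in `J` lies in
`J`. -/
theorem exists_box {x : N} {W : Set (Double g)} (hW : W ∈ 𝓝 (diag x)) :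
    ∃ V ∈ 𝓝 x, ∃ J ∈ 𝓝 (g x), J.OrdConnected ∧
      ∀ p : Double g, base p ∈ V → left p ∈ J → right p ∈ J → p ∈ W := by
  obtain ⟨W', hW', hsub⟩ := mem_nhds_subtype _ _ _ |>.1 hW
  obtain ⟨V, hV, S, hS, hVS⟩ := mem_nhds_prod_iff.1 hW'
  obtain ⟨J₁, hJ₁, J₂, hJ₂, hJS⟩ := mem_nhds_prod_iff.1 hS
  have hJ := Filter.inter_mem hJ₁ hJ₂
  refine ⟨V, hV, ordConnectedComponent (J₁ ∩ J₂) (g x), ordConnectedComponent_mem_nhds.2 hJ,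
    inferInstance, fun p hp hl hr => hsub (hVS ⟨hp, hJS ⟨?_, ?_⟩⟩)⟩
  · exact (ordConnectedComponent_subset hl).1
  · exact (ordConnectedComponent_subset hr).2

/-- The bases accumulate at some `x` by `ω₁`-compactness. Both coordinates of a term lie between its
height and the height of any later term, so the terms themselves accumulate at the diagonal point
over `x`. -/
theorem exists_diag_accumulation [T2Space N] (hN : IsOmega1Compact N) {p : Omega1 → Double g}
    (hp : ∀ η ξ, η < ξ → radius (p η) < height (p ξ)) :
    ∃ x, ∀ W ∈ 𝓝 (diag (g := g) x), {ξ | p ξ ∈ W}.Infinite := by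
  have hmono : StrictMono fun ξ => height (p ξ) := fun η ξ h =>
    (height_le_radius _).trans_lt (hp η ξ h)
  have hinj : Function.Injective fun ξ => base (p ξ) := fun η ξ h =>
    hmono.injective (congrArg g h)
  have hunc : ¬ (range fun ξ => base (p ξ)).Countable := fun h => by
    have := h.to_subtype
    exact not_countable_omega1 (rangeFactorization_injective.2 hinj).countable
  obtain ⟨x, hx⟩ := hN.exists_infinite_inter hunc
  refine ⟨x, fun W hW hfin => ?_⟩
  obtain ⟨V, hV, J, hJ, hJc, hVJ⟩ := exists_box hW
  set I : Set Omega1 := {ξ | base (p ξ) ∈ V ∩ g ⁻¹' J} with hI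
  have hIinf : I.Infinite := by
    refine Set.Infinite.of_image (fun ξ => base (p ξ)) ((hx (V ∩ g ⁻¹' J) (Filter.inter_mem hV
      (g.continuous.continuousAt.preimage_mem_nhds hJ))).mono ?_)
    rintro _ ⟨h, ξ, rfl⟩
    exact ⟨ξ, h, rfl⟩
  have key : ∀ η ∈ I, ∀ ξ ∈ I, η < ξ → p η ∈ W := fun η hη ξ hξ h => by
    have h1 := hp η ξ h
    refine hVJ _ hη.1 ?_ ?_
    · exact hJc.out hη.2 hξ.2 ⟨height_le_left _, (le_max_left _ _).trans h1.le⟩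
    · exact hJc.out hη.2 hξ.2 ⟨height_le_right _, (le_max_right _ _).trans h1.le⟩
  -- Of two indices in `I` whose terms miss `W`, the smaller contradicts `key`.
  obtain ⟨η, hη, ξ, hξ, hne⟩ := (hIinf.sdiff hfin).nontrivial
  rcases hne.lt_or_gt with h | h
  · exact hη.2 (key η hη.1 ξ hξ.1 h)
  · exact hξ.2 (key ξ hξ.1 η hη.1 h)

/-- If sets of bounded height in `A` are bounded, then there are points of `A` of large height. -/
theorem exists_height_gt {A : Set (Double g)} (hA : ¬ BddAbove (radius '' A))
    (h : ∀ a, BddAbove (radius '' {p ∈ A | height p ≤ a})) (b : LongRay) :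
    ∃ p ∈ A, b < height p := by
  obtain ⟨c, hc⟩ := h b
  obtain ⟨_, ⟨p, hp, rfl⟩, hpc⟩ := LongRay.exists_gt_mem hA c
  refine ⟨p, hp, lt_of_not_ge fun hpb => ?_⟩
  exact (hc (mem_image_of_mem _ ⟨hp, hpb⟩)).not_gt hpc

/-! ### `ω₁`-compactness and directions of the double -/

/-- An uncountable closed discrete set has unbounded radius, hence accumulates on the diagonal or on
a vertical ray, according to whether its parts of bounded height are all bounded. -/
theorem isOmega1Compact [T2Space N] [FirstCountableTopology N] (hg : IsExhaustion g)
    (hN : IsOmega1Compact N) : IsOmega1Compact (Double g) := by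
  intro D hD hD'
  by_contra hunc
  have hub : ¬ BddAbove (radius '' D) := by
    rintro ⟨b, hb⟩
    exact hunc (((isExhaustion_radius hg b).of_isClosed_subset hD
      fun p hp => hb (mem_image_of_mem _ hp)).countable_of_isDiscrete hD')
  by_cases h : ∀ a, BddAbove (radius '' {p ∈ D | height p ≤ a})
  · obtain ⟨p, hpD, hp⟩ := exists_omega1_sequence height radius (exists_height_gt hub h)
    obtain ⟨x, hx⟩ := exists_diag_accumulation hN hp
    have hmono : StrictMono fun ξ => height (p ξ) := fun η ξ h =>
      (height_le_radius _).trans_lt (hp η ξ h)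
    have hinj : Function.Injective p := fun η ξ h => hmono.injective (congrArg height h)
    refine not_forall_infinite_inter hD hD' (diag x) fun W hW =>
      ((hx W hW).image hinj.injOn).mono ?_
    rintro _ ⟨ξ, hξ, rfl⟩
    exact ⟨hξ, hpD ξ⟩
  · push Not at h
    obtain ⟨a, ha⟩ := h
    obtain ⟨j, -, -, hj⟩ := exists_ray_accumulation hg (fun p hp => hp.2) ha
    obtain ⟨z, -, hz⟩ := hj ⊥
    exact not_forall_infinite_inter hD hD' (j z) fun W hW =>
      (hz W hW).mono (inter_subset_inter_right _ (sep_subset _ _))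

theorem spannedByDirections [T2Space N] [FirstCountableTopology N] (hg : IsExhaustion g)
    (hN : IsOmega1Compact N) : SpannedByDirections (Double g) := by
  rintro U hU ⟨C, hCU, hC, hub⟩
  have hr := isExhaustion_radius hg
  rw [hr.isBounded_iff] at hub
  by_cases h : ∀ a, BddAbove (radius '' {p ∈ C | height p ≤ a})
  · suffices hx : ∃ x, range (line (g := g) x) ⊆ U by
      obtain ⟨x, hx⟩ := hx
      refine ⟨univ ∩ range (line x), by rwa [univ_inter], hr.isDirection (fun z => ?_)
        (line_radius_line x) isClosed_univ (by simp)⟩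
      rw [radius_line]
      exact le_max_left _ _
    by_contra! hx
    have hZ : ∀ x, ∃ z, line (g := g) x z ∉ U := fun x => by
      obtain ⟨_, ⟨z, rfl⟩, hz⟩ := not_subset.1 (hx x)
      exact ⟨z, hz⟩
    choose Z hZ using hZ
    -- Each height exceeds the earlier radii, which gives accumulation on the diagonal, and also the
    -- earlier exit parameters `Z`.
    obtain ⟨p, hpC, hp⟩ := exists_omega1_sequence height (fun q => max (radius q) (Z (base q)))
      (exists_height_gt hub h)
    obtain ⟨x, hx⟩ := exists_diag_accumulation hN fun η ξ h =>
      (le_max_left _ _).trans_lt (hp η ξ h)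
    have hxC : diag x ∈ C := by
      refine hC.closure_subset (mem_closure_iff_nhds.2 fun W hW => ?_)
      obtain ⟨ξ, hξ⟩ := (hx W hW).nonempty
      exact ⟨p ξ, hξ, hpC ξ⟩
    obtain ⟨V, hV, J, hJ, hJc, hVJ⟩ := exists_box (hU.mem_nhds (hCU hxC))
    have hW : height ⁻¹' J ∩ base ⁻¹' V ∈ 𝓝 (diag (g := g) x) :=
      Filter.inter_mem (height.continuous.continuousAt.preimage_mem_nhds hJ)
        (base.continuous.continuousAt.preimage_mem_nhds hV)
    -- The exit point over the base of `p η` has left coordinate `height (p η)` and right coordinate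
    -- between that and `height (p ξ)`. It would lie in the box, hence in `U`.
    have key : ∀ η ∈ {ξ | p ξ ∈ height ⁻¹' J ∩ base ⁻¹' V},
        ∀ ξ ∈ {ξ | p ξ ∈ height ⁻¹' J ∩ base ⁻¹' V}, ¬ η < ξ := fun η hη ξ hξ h => by
      have h1 : Z (base (p η)) < height (p ξ) := (le_max_right _ _).trans_lt (hp η ξ h)
      have h2 : height (p η) < height (p ξ) :=
        ((height_le_radius _).trans (le_max_left _ _)).trans_lt (hp η ξ h)
      exact hZ (base (p η)) (hVJ _ hη.2 hη.1
        (hJc.out hη.1 hξ.1 ⟨le_max_right _ _, (max_lt h1 h2).le⟩))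
    obtain ⟨η, hη, ξ, hξ, hne⟩ := (hx _ hW).nontrivial
    rcases hne.lt_or_gt with h | h
    · exact key η hη ξ hξ h
    · exact key ξ hξ η hη h
  · push Not at h
    obtain ⟨a, ha⟩ := h
    obtain ⟨j, hj1, hj2, hj⟩ := exists_ray_accumulation hg (fun p hp => hp.2) ha
    refine ⟨C ∩ range j, inter_subset_left.trans hCU, hr.isDirection hj1 hj2 hC ?_⟩
    rintro ⟨b, hb⟩
    obtain ⟨z, hbz, hz⟩ := hj b
    refine (hb (?_ : j z ∈ C)).not_gt hbz
    refine hC.closure_subset (mem_closure_iff_nhds.2 fun W hW => ?_)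
    exact (hz W hW).nonempty.mono (inter_subset_inter_right _ (sep_subset _ _))

/-- If unbounded projections of closed sets to the base can be split by maps to the long ray,
then the height is bounded on directions. -/
theorem boundedOn_of_isDirection (hg : IsExhaustion g)
    (hsplit : ∀ D : Set (Double g), IsClosed D → ¬ BddAbove (height '' D) →
      ∃ (F : C(N, LongRay)) (c : LongRay), ¬ BddAbove (F '' (base '' D)) ∧
        ¬ BddAbove (height '' {p ∈ D | F (base p) ≤ c}))
    {D : Set (Double g)} (hD : IsDirection D) : BoundedOn height D := by
  by_contra h
  obtain ⟨F, c, hF, hc⟩ := hsplit D hD.1.1 h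
  have hcl : IsClosed {p ∈ D | F (base p) ≤ c} :=
    hD.1.1.inter (isClosed_Iic.preimage (F.comp base).continuous)
  -- This club subset of `D` would have to dominate `D`, but `F ∘ base` is unbounded on `D` and
  -- bounded by `c` on the subset.
  refine (hD.2 {p ∈ D | F (base p) ≤ c} (sep_subset _ _) ⟨hcl, fun hb => hc ?_⟩).2 (F.comp base) ?_
    ⟨c, forall_mem_image.2 fun p hp => hp.2⟩
  · obtain ⟨b, hb⟩ := (isExhaustion_radius hg).isBounded_iff.1 hb
    exact ⟨b, forall_mem_image.2 fun p hp =>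
      (height_le_radius p).trans (hb (mem_image_of_mem _ hp))⟩
  · rw [image_image] at hF
    exact hF

theorem not_bddAbove_range_height (h : ¬ BddAbove (range g)) :
    ¬ BddAbove (range (height (g := g))) := fun hb =>
  h (hb.mono (by rintro _ ⟨x, rfl⟩; exact ⟨diag x, rfl⟩))

end Double

/-- Under suitable assumptions on the base, the double is a three-manifold that is spanned by
directions, and the height is unbounded but bounded on each direction. -/
theorem Double.properties {N : Type*} [TopologicalSpace N] (hN : IsTopManifold 2 N)
    {g : C(N, LongRay)} (hg : IsExhaustion g) (hub : ¬ BddAbove (range g))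
    (hω : IsOmega1Compact N)
    (hsplit : ∀ D : Set (Double g), IsClosed D → ¬ BddAbove (Double.height '' D) →
      ∃ (F : C(N, LongRay)) (c : LongRay), ¬ BddAbove (F '' (Double.base '' D)) ∧
        ¬ BddAbove (Double.height '' {p ∈ D | F (Double.base p) ≤ c})) :
    IsTopManifold 3 (Double g) ∧ IsTypeI (Double g) ∧ IsOmega1Compact (Double g) ∧
      SpannedByDirections (Double g) ∧ ∃ f : C(Double g, LongRay), ¬ BoundedOn f univ ∧
        ∀ D : Set (Double g), IsDirection D → BoundedOn f D := by
  have := hN.t2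
  have := hN.connected
  have hE := IsLocallyEuclidean.of_isTopManifold hN
  have := hE.firstCountableTopology
  refine ⟨⟨inferInstance, Double.connectedSpace,
    (Double.isLocallyEuclidean hE).exists_homeomorph⟩,
    (Double.isExhaustion_radius hg).isTypeI fun h => Double.not_bddAbove_range_height hub ?_,
    Double.isOmega1Compact hg hω, Double.spannedByDirections hg hω, Double.height, ?_,
    fun D hD => Double.boundedOn_of_isDirection hg hsplit hD⟩
  · obtain ⟨b, hb⟩ := h
    exact ⟨b, forall_mem_range.2 fun p => (Double.height_le_radius p).trans (hb ⟨p, rfl⟩)⟩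
  · rw [BoundedOn, image_univ]
    exact Double.not_bddAbove_range_height hub

/-! ### `ω`-bounded surfaces -/

section OmegaBounded

variable {N : Type*} [TopologicalSpace N]

theorem IsOmegaBounded.isCountablyCompact_univ (h : IsOmegaBounded N) :
    IsCountablyCompact (univ : Set N) := by
  refine isCountablyCompact_iff_seq_clusterPt.2 fun x _ => ?_
  obtain ⟨a, -, ha⟩ := (h _ (countable_range x)).isCountablyCompact (f := Filter.map x Filter.atTop)
    (Filter.le_principal_iff.2 (Filter.mem_map.2 (Filter.univ_mem' fun n =>
      subset_closure ⟨n, rfl⟩)))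
  exact ⟨a, trivial, ha⟩

theorem IsOmegaBounded.isCompact (h : IsOmegaBounded N) {K : Set N} (hK : IsClosed K)
    (hK' : IsLindelof K) : IsCompact K :=
  IsLindelof.isCompact (h.isCountablyCompact_univ.of_isClosed_subset hK (subset_univ K)) hK'

/-- Urysohn functions `f α`, rising from `0` on the closure of `U α` to `1` off the next set, are
concatenated. The first `α` with `f α x < 1` is the ordinal part and `f α x` the fractional part.
Continuity needs no condition on `U` at limit ordinals. -/
theorem exists_isExhaustion [T2Space N] [LocallyCompactSpace N] (h : IsOmegaBounded N)
    {U : Omega1 → Set N} (hU : IsTypeISeq U) : ∃ g : C(N, LongRay), IsExhaustion g := by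
  have hury : ∀ α, ∃ f : C(N, ℝ), EqOn f 0 (closure (U α)) ∧ EqOn f 1 (U (Order.succ α))ᶜ ∧
      ∀ x, f x ∈ Icc (0 : ℝ) 1 := fun α =>
    exists_continuous_zero_one_of_isCompact
      (h.isCompact isClosed_closure (hU.isLindelof_closure α)) (hU.isOpen _).isClosed_compl
      (disjoint_compl_right_iff_subset.2 (hU.closure_subset _ _ (Order.lt_succ α)))
  choose f hf0 hf1 hf using hury
  have hex : ∀ x, ∃ α, f α x < 1 := fun x => by
    obtain ⟨α, hα⟩ := mem_iUnion.1 (hU.iUnion_eq.ge (mem_univ x))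
    exact ⟨α, by rw [hf0 α (subset_closure hα)]; exact zero_lt_one⟩
  let ρ : N → Omega1 := fun x => wellFounded_lt.min {α | f α x < 1} (hex x)
  have hρ : ∀ x, f (ρ x) x < 1 := fun x => wellFounded_lt.min_mem {α | f α x < 1} (hex x)
  have hlt : ∀ x α, α < ρ x → f α x = 1 := fun x α hα =>
    le_antisymm (hf α x).2 (not_lt.1 fun h => wellFounded_lt.not_lt_min {α | f α x < 1} h hα)
  have hmem : ∀ x α, f α x < 1 → x ∈ U (Order.succ α) := fun x α h => by
    by_contra hx
    rw [hf1 α hx] at h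
    exact lt_irrefl _ h
  have hgt : ∀ x α, ρ x < α → f α x = 0 := fun x α hα => by
    refine hf0 α ?_
    rcases (Order.succ_le_of_lt hα).lt_or_eq with h | h
    · exact subset_closure (hU.closure_subset _ _ h (subset_closure (hmem x _ (hρ x))))
    · exact subset_closure (h ▸ hmem x _ (hρ x))
  let G : N → LongRay := fun x => LongRay.mk (ρ x) ⟨f (ρ x) x, (hf _ x).1, hρ x⟩
  have hIoi : ∀ a, G ⁻¹' Ioi a = {x | (a.snd : ℝ) < f a.fst x} := fun a => by
    ext x
    simp only [mem_preimage, mem_Ioi, LongRay.lt_iff, G, LongRay.fst_mk, LongRay.snd_mk]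
    rcases lt_trichotomy a.fst (ρ x) with h | h | h
    · simp [h, hlt x _ h, a.snd_lt_one]
    · simp [h]
    · simp [h.not_gt, h.ne', hgt x _ h, a.snd_nonneg]
  have hIio : ∀ a, G ⁻¹' Iio a = (⋃ α ∈ Iio a.fst, {x | f α x < 1}) ∪
      {x | f a.fst x < a.snd} := fun a => by
    ext x
    simp only [mem_preimage, mem_Iio, LongRay.lt_iff, G, LongRay.fst_mk, LongRay.snd_mk,
      mem_union, mem_iUnion, exists_prop]
    constructor
    · rintro (h | ⟨h, h'⟩)
      · exact Or.inl ⟨_, h, hρ x⟩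
      · exact Or.inr (by rw [← h]; exact h')
    · rintro (⟨α, hα, hx⟩ | hx)
      · exact Or.inl ((not_lt.1 fun h => (hlt x α h).not_lt hx).trans_lt hα)
      · have hx' : f a.fst x < a.snd := hx
        rcases lt_trichotomy (ρ x) a.fst with h | h | h
        · exact Or.inl h
        · exact Or.inr ⟨h, by rw [h]; exact hx'⟩
        · exact absurd (hlt x _ h) (hx'.trans a.snd_lt_one).ne
  have hG : Continuous G := by
    refine OrderTopology.continuous_iff.2 fun a => ⟨?_, ?_⟩
    · rw [hIoi]
      exact isOpen_lt continuous_const (f _).continuous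
    · rw [hIio]
      exact (isOpen_biUnion fun α _ => isOpen_lt (f α).continuous continuous_const).union
        (isOpen_lt (f _).continuous continuous_const)
  refine ⟨⟨G, hG⟩, fun a => (hU.isLindelof_closure (Order.succ a.fst)).of_isClosed_subset
    (isClosed_Iic.preimage hG) fun x hx => subset_closure (hmem x _ ?_)⟩
  have hx' : x ∉ G ⁻¹' Ioi a := fun h => (show a < G x from h).not_ge hx
  rw [hIoi] at hx'
  exact (not_lt.1 hx').trans_lt a.snd_lt_one

/-- Lift a convergent sequence of the image to `D`; by `ω`-boundedness of the double the lifts have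
compact closure, whose image contains the limit. -/
theorem isClosed_image_base [T2Space N] [FirstCountableTopology N] (h : IsOmegaBounded N)
    {g : C(N, LongRay)} {D : Set (Double g)} (hD : IsClosed D) : IsClosed (Double.base '' D) := by
  refine isClosed_of_closure_subset fun x hx => ?_
  obtain ⟨y, hyD, hy⟩ := mem_closure_iff_seq_limit.1 hx
  choose p hpD hp using hyD
  have hK := Double.isOmegaBounded (g := g) h _ (countable_range p)
  have hKD : closure (range p) ⊆ D := closure_minimal (range_subset_iff.2 hpD) hD
  refine image_mono hKD ((hK.image Double.base.continuous).isClosed.mem_of_tendsto hy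
    (Filter.Eventually.of_forall fun n => ?_))
  exact ⟨p n, subset_closure ⟨n, rfl⟩, hp n⟩

theorem NyikosSurface.exists_double (h : NyikosSurface) :
    ∃ (M : Type) (_ : TopologicalSpace M), IsTopManifold 3 M ∧ IsTypeI M ∧ IsOmegaBounded M ∧
      SpannedByDirections M ∧ ∃ f : C(M, LongRay), ¬ BoundedOn f univ ∧
        ∀ D : Set M, IsDirection D → BoundedOn f D := by
  obtain ⟨N, _, hN, ⟨⟨U, hU⟩, hL⟩, hω, hdir⟩ := h
  have := hN.t2
  have hE := IsLocallyEuclidean.of_isTopManifold hN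
  have := hE.firstCountableTopology
  have := hE.locallyCompactSpace
  obtain ⟨g, hg⟩ := exists_isExhaustion hω hU
  have hub : ¬ BddAbove (range g) := by
    rintro ⟨b, hb⟩
    refine hL ⟨?_⟩
    rw [show (univ : Set N) = {x | g x ≤ b} from (eq_univ_of_forall fun x => hb ⟨x, rfl⟩).symm]
    exact hg b
  have hsplit : ∀ D : Set (Double g), IsClosed D → ¬ BddAbove (Double.height '' D) →
      ∃ (F : C(N, LongRay)) (c : LongRay), ¬ BddAbove (F '' (Double.base '' D)) ∧
        ¬ BddAbove (Double.height '' {p ∈ D | F (Double.base p) ≤ c}) := by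
    intro D hD hDub
    have himg : ∀ E : Set N, IsBounded E ↔ BddAbove (g '' E) := fun E => hg.isBounded_iff
    have hclub : IsClubSet (Double.base '' D) := by
      refine ⟨isClosed_image_base hω hD, ?_⟩
      rw [himg, image_image]
      exact hDub
    -- The projection of `D` is a club set but not a direction, and `C ⪯ D` is automatic for
    -- subsets, so the converse relation fails for some club subset.
    have hnd : ∃ C ⊆ Double.base '' D, IsClubSet C ∧ ¬ UfoLE (Double.base '' D) C := by
      by_contra! hno
      exact hdir _ ⟨hclub, fun C hCD hC => ⟨fun f hf hf' => hf (hf'.mono (image_mono hCD)),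
        hno C hCD hC⟩⟩
    obtain ⟨C, hCD, hC, hF⟩ := hnd
    rw [UfoLE] at hF
    push Not at hF
    obtain ⟨F, hFD, c, hc⟩ := hF
    refine ⟨F, c, hFD, fun hb => hC.2 ((himg C).2 (hb.mono ?_))⟩
    rintro _ ⟨x, hx, rfl⟩
    obtain ⟨p, hp, rfl⟩ := hCD hx
    exact ⟨p, ⟨hp, hc (mem_image_of_mem _ hx)⟩, rfl⟩
  obtain ⟨hM, hI, -, hS, hf⟩ := Double.properties hN hg hub hω.isOmega1Compact hsplit
  exact ⟨Double g, inferInstance, hM, hI, Double.isOmegaBounded hω, hS, hf⟩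

end OmegaBounded

/-! ### Heights in Suslin trees -/

theorem IsSuslinTree.wf {T : Type*} [PartialOrder T] (hT : IsSuslinTree T) :
    WellFounded ((· < ·) : T → T → Prop) := by
  refine WellFounded.wellFounded_iff_has_min.2 fun s ⟨x, hx⟩ => ?_
  by_cases h : (Iio x ∩ s).Nonempty
  · have hwf : (Iio x ∩ s).IsWF := (hT.isWF_Iio x).mono inter_subset_left
    exact ⟨hwf.min h, (hwf.min_mem h).2, fun y hy hlt =>
      hwf.not_lt_min h ⟨hlt.trans (hwf.min_mem h).1, hy⟩ hlt⟩
  · exact ⟨x, hx, fun y hy hlt => h ⟨y, hlt, hy⟩⟩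

theorem IsSuslinTree.exists_height {T : Type*} [PartialOrder T] (hT : IsSuslinTree T) :
    ∃ ht : T → Omega1, StrictMono ht ∧ ∀ x, ∀ β < ht x, ∃ y < x, ht y = β := by
  have hwf := hT.wf
  have hex : ∀ (x : T) (q : ∀ y, y < x → Omega1), ∃ β, ∀ y (h : y < x), q y h < β := fun x q => by
    have : Countable (Iio x) := (hT.countable_of_isChain _ (hT.isChain_Iio x)).to_subtype
    obtain ⟨β, hβ⟩ := exists_gt_of_countable (countable_range fun y : Iio x => q y.1 y.2)
    exact ⟨β, fun y h => hβ _ ⟨⟨y, h⟩, rfl⟩⟩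
  -- The rank: the least ordinal above the ranks of all predecessors, of which there are countably
  -- many.
  let ht : T → Omega1 := hwf.fix fun x q => wellFounded_lt.min {β | ∀ y (h : y < x), q y h < β}
    (hex x q)
  have hht : ∀ x, ht x = wellFounded_lt.min {β | ∀ y, y < x → ht y < β} (hex x fun y _ => ht y) :=
    fun x => hwf.fix_eq _ x
  refine ⟨ht, fun y x h => ?_, fun x => ?_⟩
  · have := wellFounded_lt.min_mem {β | ∀ y, y < x → ht y < β} (hex x fun y _ => ht y)
    rw [← hht] at this
    exact this y h
  · induction x using hwf.induction with
    | _ x ih =>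
      intro β hβ
      rw [hht] at hβ
      have h := fun h => wellFounded_lt.not_lt_min {β | ∀ y, y < x → ht y < β} h hβ
      simp only [mem_ofPred_eq] at h
      have h' : ∃ y < x, β ≤ ht y := by
        by_contra! hno
        exact h hno
      obtain ⟨y, hy, hle⟩ := h'
      rcases hle.eq_or_lt with rfl | hlt
      · exact ⟨y, hy, rfl⟩
      · obtain ⟨z, hz, hzβ⟩ := ih y hy β hlt
        exact ⟨z, hz.trans hy, hzβ⟩

/-- A Suslin tree together with the heights of its elements and enumerations of its levels by
positive natural numbers. -/
structure LeveledSuslinTree (T : Type*) [PartialOrder T] where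
  /-- The underlying tree is a Suslin tree. -/
  isSuslinTree : IsSuslinTree T
  /-- The height of an element. -/
  ht : T → Omega1
  ht_strictMono : StrictMono ht
  exists_lt : ∀ x, ∀ β < ht x, ∃ y < x, ht y = β
  /-- The number of an element in its level. -/
  num : T → ℕ
  num_ne_zero : ∀ x, num x ≠ 0
  num_inj : ∀ x y, ht x = ht y → num x = num y → x = y

theorem isAntichain_level {T : Type*} [PartialOrder T] {ht : T → Omega1} (h : StrictMono ht)
    (β : Omega1) : IsAntichain (· ≤ ·) {x | ht x = β} := by
  intro x hx y hy hne hle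
  have := h (lt_of_le_of_ne hle hne)
  rw [show ht x = β from hx, show ht y = β from hy] at this
  exact lt_irrefl _ this

theorem IsSuslinTree.exists_leveled {T : Type*} [PartialOrder T] (hT : IsSuslinTree T) :
    Nonempty (LeveledSuslinTree T) := by
  obtain ⟨ht, h1, h2⟩ := hT.exists_height
  have hc : ∀ β, ∃ f : T → ℕ, InjOn f {x | ht x = β} := fun β =>
    countable_iff_exists_injOn.1 (hT.countable_of_isAntichain _ (isAntichain_level h1 β))
  choose f hf using hc
  -- The value `0` is reserved for marking the end of a sequence in `code`.
  exact ⟨⟨hT, ht, h1, h2, fun x => f (ht x) x + 1, fun x => Nat.succ_ne_zero _, fun x y h h' =>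
    hf (ht y) h rfl (by rw [h] at h'; exact Nat.succ_injective h')⟩⟩

namespace LeveledSuslinTree

variable {T : Type*} [PartialOrder T] (L : LeveledSuslinTree T)

theorem countable_ht_le (β : Omega1) : {x | L.ht x ≤ β}.Countable := by
  have : {x | L.ht x ≤ β} = ⋃ γ ∈ Iic β, {x | L.ht x = γ} := by
    ext x
    simp
  rw [this]
  exact (countable_Iic_omega1 β).biUnion fun γ _ =>
    L.isSuslinTree.countable_of_isAntichain _ (isAntichain_level L.ht_strictMono γ)

theorem not_countable (L : LeveledSuslinTree T) : ¬ Countable T := fun h => by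
  have h1 := Cardinal.mk_le_aleph0_iff.2 h
  rw [L.isSuslinTree.card_eq, ← Cardinal.succ_aleph0] at h1
  exact (Order.lt_succ ℵ₀).not_ge h1

theorem le_or_le (L : LeveledSuslinTree T) {x y z : T} (hx : x < z) (hy : y < z) : x ≤ y ∨ y ≤ x :=
  (L.isSuslinTree.isChain_Iio z).total hx hy

theorem lt_of_ht_lt {x y z : T} (hx : x < z) (hy : y < z) (h : L.ht x < L.ht y) : x < y := by
  rcases L.le_or_le hx hy with h' | h'
  · exact lt_of_le_of_ne h' (by rintro rfl; exact lt_irrefl _ h)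
  · exact absurd h (L.ht_strictMono.monotone h').not_gt

theorem eq_of_ht_eq {x y z : T} (hx : x < z) (hy : y < z) (h : L.ht x = L.ht y) : x = y := by
  rcases L.le_or_le hx hy with h' | h'
  · by_contra hne
    exact (L.ht_strictMono (lt_of_le_of_ne h' hne)).ne h
  · by_contra hne
    exact (L.ht_strictMono (lt_of_le_of_ne h' (Ne.symm hne))).ne h.symm

theorem exists_ht_ge {A : Set T} (hA : ¬ A.Countable) (β : Omega1) : ∃ x ∈ A, β < L.ht x := by
  by_contra! h
  exact hA ((L.countable_ht_le β).mono h)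

/-- An uncountable set in a Suslin tree is cofinal below some element. -/
theorem exists_cofinal {A : Set T} (hA : ¬ A.Countable) :
    ∃ t, (∃ β, β < L.ht t) ∧ ∀ β < L.ht t, ∃ s ∈ A, s < t ∧ β < L.ht s := by
  -- The minimal elements of `A` above height `β` form an antichain, so their heights are bounded by
  -- some `c β`.
  let m : Omega1 → Set T := fun β => {x ∈ A | β < L.ht x ∧ ∀ y ∈ A, y < x → ¬ β < L.ht y}
  have hanti : ∀ β, IsAntichain (· ≤ ·) (m β) := fun β x hx y hy hne hle =>
    hy.2.2 x hx.1 (lt_of_le_of_ne hle hne) hx.2.1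
  have hmin : ∀ β, ∀ x ∈ A, β < L.ht x → ∃ y ∈ m β, y ≤ x := fun β x hx hβ => by
    obtain ⟨y, ⟨hyA, hyβ, hyx⟩, hy⟩ := WellFounded.wellFounded_iff_has_min.1
      L.isSuslinTree.wf {y | y ∈ A ∧ β < L.ht y ∧ y ≤ x} ⟨x, hx, hβ, le_rfl⟩
    exact ⟨y, ⟨hyA, hyβ, fun z hz hzy hzβ => hy z ⟨hz, hzβ, hzy.le.trans hyx⟩ hzy⟩, hyx⟩
  have hc : ∀ β, ∃ γ, β < γ ∧ ∀ x ∈ m β, L.ht x < γ := fun β => by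
    obtain ⟨γ, hγ⟩ := exists_gt_of_countable
      (((L.isSuslinTree.countable_of_isAntichain _ (hanti β)).image L.ht).insert β)
    exact ⟨γ, hγ _ (mem_insert _ _), fun x hx => hγ _ (mem_insert_of_mem _ (mem_image_of_mem _ hx))⟩
  choose c hc hcm using hc
  -- The supremum `δ` of the iterates of `c` is closed under this bound. Below any `a ∈ A` of height
  -- beyond `δ`, the elements of `A` minimal above height `b n` have height below `δ`, so they
  -- precede the predecessor `t` of `a` at height `δ`.
  let b : ℕ → Omega1 := fun n => c^[n] (Classical.arbitrary _)
  have hb : ∀ n, b (n + 1) = c (b n) := fun n => Function.iterate_succ_apply' _ _ _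
  obtain ⟨ε, hε⟩ := exists_gt_of_countable (countable_range b)
  set s : Set Omega1 := {δ | ∀ n, b n < δ} with hs
  have hne : s.Nonempty := ⟨ε, fun n => hε _ ⟨n, rfl⟩⟩
  set δ := wellFounded_lt.min s hne with hδ
  have hδs : ∀ n, b n < δ := wellFounded_lt.min_mem s hne
  have hδmin : ∀ β < δ, ∃ n, β ≤ b n := fun β hβ => by
    by_contra! h
    exact wellFounded_lt.not_lt_min s (x := β) h hβ
  obtain ⟨a, haA, ha⟩ := L.exists_ht_ge hA δ
  obtain ⟨t, hta, htδ⟩ := L.exists_lt a δ ha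
  refine ⟨t, ⟨b 0, by rw [htδ]; exact hδs 0⟩, fun β hβ => ?_⟩
  obtain ⟨n, hn⟩ := hδmin β (by rwa [htδ] at hβ)
  obtain ⟨y, hy, hya⟩ := hmin (b n) a haA ((hδs n).trans ha)
  have hyδ : L.ht y < δ := (hcm _ y hy).trans (by rw [← hb]; exact hδs _)
  have hya' : y < a := lt_of_le_of_ne hya (by rintro rfl; exact (hyδ.trans ha).false)
  exact ⟨y, hy.1, L.lt_of_ht_lt hya' hta (by rwa [htδ]), hn.trans_lt hy.2.1⟩

open Classical in
/-- The sequence of the numbers of the predecessors of an element, extended by zeros. -/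
noncomputable def code (t : T) (β : Omega1) : ℕ :=
  if h : ∃ s < t, L.ht s = β then L.num h.choose else 0

theorem code_of_lt {s t : T} (h : s < t) : L.code t (L.ht s) = L.num s := by
  have hex : ∃ r < t, L.ht r = L.ht s := ⟨s, h, rfl⟩
  rw [code, dif_pos hex, L.eq_of_ht_eq hex.choose_spec.1 h hex.choose_spec.2]

theorem code_ne_zero_iff {t : T} {β : Omega1} : L.code t β ≠ 0 ↔ β < L.ht t := by
  constructor
  · intro h
    by_contra hβ
    refine h (dif_neg ?_)
    rintro ⟨s, hs, rfl⟩
    exact hβ (L.ht_strictMono hs)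
  · intro h
    obtain ⟨s, hs, rfl⟩ := L.exists_lt t β h
    rw [L.code_of_lt hs]
    exact L.num_ne_zero s

theorem lt_of_code_eq {s t : T} (h : L.code t (L.ht s) = L.num s) : s < t := by
  have h0 : L.code t (L.ht s) ≠ 0 := by rw [h]; exact L.num_ne_zero s
  obtain ⟨r, hr, hrs⟩ := L.exists_lt t _ (L.code_ne_zero_iff.1 h0)
  rw [← hrs, L.code_of_lt hr] at h
  rwa [← L.num_inj r s hrs h]

theorem code_eq_of_lt {s t : T} (h : s < t) {β : Omega1} (hβ : β < L.ht s) :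
    L.code s β = L.code t β := by
  obtain ⟨r, hr, rfl⟩ := L.exists_lt s β hβ
  rw [L.code_of_lt hr, L.code_of_lt (hr.trans h)]

end LeveledSuslinTree

/-! ### Line bundles over trees of sequences -/

/-- Truncation of a sequence of length `ω₁`. -/
noncomputable def truncate (s : Omega1 → ℕ) (β : Omega1) : Omega1 → ℕ :=
  open Classical in fun γ => if γ < β then s γ else 0

/-- A family of sequences of natural numbers, each with an initial segment of `ω₁` as its support,
that is closed under truncations. -/
structure IsSequenceTree (S : Set (Omega1 → ℕ)) : Prop where
  exists_length : ∀ s ∈ S, ∃ σ, ∀ γ, s γ ≠ 0 ↔ γ < σ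
  truncate_mem : ∀ s ∈ S, ∀ β, truncate s β ∈ S

theorem truncate_of_lt {s : Omega1 → ℕ} {β γ : Omega1} (h : γ < β) : truncate s β γ = s γ := by
  simp [truncate, h]

theorem truncate_of_le {s : Omega1 → ℕ} {β γ : Omega1} (h : β ≤ γ) : truncate s β γ = 0 := by
  simp [truncate, h.not_gt]

theorem truncate_eq_self {s : Omega1 → ℕ} {β : Omega1} (h : ∀ γ, s γ ≠ 0 → γ < β) :
    truncate s β = s := by
  ext γ
  rcases lt_or_ge γ β with h' | h'
  · exact truncate_of_lt h'
  · rw [truncate_of_le h']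
    by_contra hne
    exact (h γ (Ne.symm hne)).not_ge h'

/-- The points of a surface that fibers over the edges and the nodes of a tree of sequences, with
real lines as its fibers. -/
@[ext]
structure TreeSurface (S : Set (Omega1 → ℕ)) where
  /-- The node of the tree below the point. -/
  node : Omega1 → ℕ
  /-- The height of the point. -/
  height : LongRay
  /-- The coordinate in the fiber. -/
  coord : ℝ
  node_mem : node ∈ S
  node_ne_zero_iff : ∀ γ, node γ ≠ 0 ↔ γ < height.fst
  -- Without the least height the surface has no boundary.
  height_pos : ⊥ < height

namespace TreeSurface

variable {S : Set (Omega1 → ℕ)}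

/-- The shift between the fiber coordinate of a point of the long ray and the coordinate along a
branch. -/
noncomputable def shift (s : Omega1 → ℕ) (h : LongRay) : ℝ :=
  s h.fst * ((h.snd : ℝ) / (1 - h.snd))

open Classical in
/-- The coordinate along a branch, which is infinite off the branch. -/
noncomputable def branchCoord (s : Omega1 → ℕ) (x : TreeSurface S) : OnePoint ℝ :=
  if x.node = truncate s x.height.fst then ↑(x.coord - shift s x.height) else OnePoint.infty

/-- The initial topology of the height and all branch coordinates. A point that leaves a branch
tends to infinity in its coordinate, so branches are open and no non-separated points arise where
they split. -/
noncomputable instance : TopologicalSpace (TreeSurface S) :=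
  TopologicalSpace.induced (fun x => (x.height, fun s : S => branchCoord s.1 x)) inferInstance

theorem continuous_height : Continuous (height : TreeSurface S → LongRay) :=
  continuous_fst.comp (continuous_induced_dom (f := fun x : TreeSurface S =>
    (x.height, fun s : S => branchCoord s.1 x)))

theorem continuous_branchCoord {s : Omega1 → ℕ} (hs : s ∈ S) :
    Continuous (branchCoord s : TreeSurface S → OnePoint ℝ) :=
  (continuous_apply (⟨s, hs⟩ : S)).comp (continuous_snd.comp
    (continuous_induced_dom (f := fun x : TreeSurface S =>
      (x.height, fun s : S => branchCoord s.1 x))))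

theorem branchCoord_ne_infty_iff {s : Omega1 → ℕ} {x : TreeSurface S} :
    branchCoord s x ≠ OnePoint.infty ↔ x.node = truncate s x.height.fst := by
  rw [branchCoord]
  split_ifs with h <;> simp [h]

theorem branchCoord_of_eq {s : Omega1 → ℕ} {x : TreeSurface S}
    (h : x.node = truncate s x.height.fst) :
    branchCoord s x = ↑(x.coord - shift s x.height) := if_pos h

theorem node_eq_truncate (x : TreeSurface S) : x.node = truncate x.node x.height.fst :=
  (truncate_eq_self fun γ h => (x.node_ne_zero_iff γ).1 h).symm

theorem node_height (x : TreeSurface S) : x.node x.height.fst = 0 := by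
  by_contra h
  exact lt_irrefl _ ((x.node_ne_zero_iff _).1 h)

theorem branchCoord_node (x : TreeSurface S) : branchCoord x.node x = ↑x.coord := by
  rw [branchCoord_of_eq x.node_eq_truncate, shift, x.node_height]
  simp

instance : T2Space (TreeSurface S) := by
  refine T2Space.of_injective_continuous (f := fun x : TreeSurface S =>
    (x.height, fun s : S => branchCoord s.1 x)) (fun x y h => ?_) continuous_induced_dom
  have hh : x.height = y.height := congrArg Prod.fst h
  have hb : branchCoord x.node x = branchCoord x.node y :=
    congrFun (congrArg Prod.snd h) ⟨x.node, x.node_mem⟩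
  rw [branchCoord_node] at hb
  have hn : y.node = x.node := by
    rw [branchCoord_ne_infty_iff.1 (hb ▸ OnePoint.coe_ne_infty _ : branchCoord x.node y ≠ _), ← hh,
      ← node_eq_truncate]
  rw [← hn, branchCoord_node] at hb
  exact TreeSurface.ext hn.symm hh (OnePoint.coe_injective hb)

/-! #### Charts -/

/-- The transition between branches that split in a given step. -/
theorem continuous_transition {m : ℝ} (hm : m ≠ 0) : Continuous (open Classical in
    fun q : ℝ × ℝ => if q.2 < 1 then ((q.1 + m * (q.2 / (1 - q.2)) : ℝ) : OnePoint ℝ)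
      else OnePoint.infty) := by
  refine continuous_iff_continuousAt.2 fun q => ?_
  rcases lt_trichotomy q.2 1 with h | h | h
  · have hev : ∀ᶠ r : ℝ × ℝ in 𝓝 q, r.2 < 1 :=
      (isOpen_lt continuous_snd continuous_const).mem_nhds h
    have hc : ContinuousAt
        (fun r : ℝ × ℝ => ((r.1 + m * (r.2 / (1 - r.2)) : ℝ) : OnePoint ℝ)) q := by
      refine OnePoint.continuous_coe.continuousAt.comp ?_
      have : 1 - q.2 ≠ 0 := by linarith
      fun_prop (disch := assumption)
    exact hc.congr (hev.mono fun r hr => (if_pos hr).symm)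
  · rw [ContinuousAt, if_neg h.not_lt, OnePoint.hasBasis_nhds_infty.tendsto_right_iff]
    rintro K ⟨-, hK⟩
    obtain ⟨R, hR⟩ := hK.isBounded.exists_norm_le
    -- Escape from the ball of radius `R`, with the denominator `1 - r.2` cleared: the condition is
    -- then open and holds at `r.2 = 1` because `m ≠ 0`.
    have hopen : IsOpen {r : ℝ × ℝ | R * (1 - r.2) < |r.1 * (1 - r.2) + m * r.2|} :=
      isOpen_lt (by fun_prop) (by fun_prop)
    filter_upwards [hopen.mem_nhds (show q ∈ _ by simp [h, hm])] with r hr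
    by_cases h1 : r.2 < 1
    · rw [if_pos h1]
      refine Or.inl ⟨_, fun hmem => ?_, rfl⟩
      have hpos : 0 < 1 - r.2 := by linarith
      have h2 := hR _ hmem
      have h3 : r.1 + m * (r.2 / (1 - r.2)) = (r.1 * (1 - r.2) + m * r.2) / (1 - r.2) := by
        field_simp
      rw [h3, Real.norm_eq_abs, abs_div, abs_of_pos hpos, div_le_iff₀ hpos] at h2
      exact h2.not_gt hr
    · rw [if_neg h1]
      exact Or.inr rfl
  · have hev : ∀ᶠ r : ℝ × ℝ in 𝓝 q, 1 < r.2 :=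
      (isOpen_lt continuous_const continuous_snd).mem_nhds h
    exact (continuousAt_const (y := OnePoint.infty)).congr
      (hev.mono fun r hr => (if_neg hr.not_gt).symm)

/-- The point of the branch `s` with given height and coordinate. -/
noncomputable def point (hS : IsSequenceTree S) {s : Omega1 → ℕ} (hs : s ∈ S) {σ : Omega1}
    (hσ : ∀ γ, s γ ≠ 0 ↔ γ < σ) (q : Ioo ⊥ (LongRay.ord (Order.succ σ)) × ℝ) : TreeSurface S where
  node := truncate s q.1.1.fst
  height := q.1.1
  coord := q.2 + shift s q.1.1
  node_mem := hS.truncate_mem s hs _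
  node_ne_zero_iff γ := by
    have h := Order.lt_succ_iff.1 (LongRay.lt_ord_iff.1 q.1.2.2)
    rcases lt_or_ge γ q.1.1.fst with h' | h'
    · simp [truncate_of_lt h', h', hσ, h'.trans_le h]
    · simp [truncate_of_le h', h'.not_gt]
  height_pos := q.1.2.1

theorem branchCoord_point (hS : IsSequenceTree S) {s : Omega1 → ℕ} (hs : s ∈ S) {σ : Omega1}
    (hσ : ∀ γ, s γ ≠ 0 ↔ γ < σ) (q : Ioo ⊥ (LongRay.ord (Order.succ σ)) × ℝ) :
    branchCoord s (point hS hs hσ q) = ↑q.2 := by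
  rw [branchCoord_of_eq rfl]
  simp [point]

/-- In the coordinate of another branch `t`, first differing from `s` at `γ`, a point of `s` is
shifted by `(s γ - t γ) θ / (1 - θ)`, where `θ` is the step function at `γ`, and is infinite once `θ
= 1`. -/
theorem continuous_point (hS : IsSequenceTree S) {s : Omega1 → ℕ} (hs : s ∈ S) {σ : Omega1}
    (hσ : ∀ γ, s γ ≠ 0 ↔ γ < σ) : Continuous (point hS hs hσ) := by
  refine continuous_induced_rng.2 (Continuous.prodMk (by fun_prop) (continuous_pi ?_))
  rintro ⟨t, ht⟩
  by_cases hst : s = t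
  · subst hst
    exact (OnePoint.continuous_coe.comp continuous_snd).congr fun q =>
      (branchCoord_point hS hs hσ q).symm
  · have hne : {γ | s γ ≠ t γ}.Nonempty := Function.ne_iff.1 hst
    set γ := wellFounded_lt.min _ hne with hγ
    have hγne : s γ ≠ t γ := wellFounded_lt.min_mem _ hne
    have hγlt : ∀ β < γ, s β = t β := fun β hβ => by
      by_contra h
      exact wellFounded_lt.not_lt_min {γ | s γ ≠ t γ} h hβ
    have hm : (s γ : ℝ) - t γ ≠ 0 := sub_ne_zero.2 (Nat.cast_injective.ne hγne)
    refine ((continuous_transition hm).comp (f := fun q : Ioo ⊥ (LongRay.ord (Order.succ σ)) × ℝ =>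
      (q.2, LongRay.step γ q.1.1)) (continuous_snd.prodMk ((LongRay.continuous_step γ).comp
        (continuous_subtype_val.comp continuous_fst)))).congr fun q => ?_
    simp only [Function.comp_apply]
    have heq : q.1.1.fst ≤ γ → truncate s q.1.1.fst = truncate t q.1.1.fst := fun h => by
      ext β
      rcases lt_or_ge β q.1.1.fst with h' | h'
      · rw [truncate_of_lt h', truncate_of_lt h', hγlt β (h'.trans_le h)]
      · rw [truncate_of_le h', truncate_of_le h']
    rcases lt_trichotomy q.1.1.fst γ with h | h | h
    · rw [LongRay.step_of_fst_lt h, if_pos zero_lt_one, branchCoord_of_eq (heq h.le)]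
      simp [point, shift, hγlt _ h]
    · rw [LongRay.step_of_fst_eq h, if_pos (LongRay.snd_lt_one _), branchCoord_of_eq (heq h.le)]
      simp only [point, shift, h]
      congr 1
      ring
    · rw [LongRay.step_of_lt_fst h, if_neg (lt_irrefl _), branchCoord, if_neg]
      intro h'
      have := congrFun h' γ
      change truncate s q.1.1.fst γ = truncate t q.1.1.fst γ at this
      rw [truncate_of_lt h, truncate_of_lt h] at this
      exact hγne this

/-- The open set of the points on a branch. -/
def branch (S : Set (Omega1 → ℕ)) (s : Omega1 → ℕ) : Set (TreeSurface S) :=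
  {x | branchCoord s x ≠ OnePoint.infty}

theorem mem_branch_iff {s : Omega1 → ℕ} {x : TreeSurface S} :
    x ∈ branch S s ↔ x.node = truncate s x.height.fst := branchCoord_ne_infty_iff

theorem isOpen_branch {s : Omega1 → ℕ} (hs : s ∈ S) : IsOpen (branch S s) :=
  (isOpen_compl_singleton (x := OnePoint.infty)).preimage (continuous_branchCoord hs)

theorem mem_branch_node (x : TreeSurface S) : x ∈ branch S x.node :=
  mem_branch_iff.2 x.node_eq_truncate

theorem height_fst_le {s : Omega1 → ℕ} {σ : Omega1} (hσ : ∀ γ, s γ ≠ 0 ↔ γ < σ)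
    {x : TreeSurface S} (hx : x ∈ branch S s) : x.height.fst ≤ σ := by
  by_contra! h
  have h1 := (x.node_ne_zero_iff σ).2 h
  rw [mem_branch_iff.1 hx, truncate_of_lt h] at h1
  exact lt_irrefl _ ((hσ σ).1 h1)

/-- The chart along a branch. -/
noncomputable def branchHomeomorph (hS : IsSequenceTree S) {s : Omega1 → ℕ} (hs : s ∈ S)
    {σ : Omega1} (hσ : ∀ γ, s γ ≠ 0 ↔ γ < σ) :
    branch S s ≃ₜ Ioo ⊥ (LongRay.ord (Order.succ σ)) × ℝ where
  toFun x := (⟨x.1.height, x.1.height_pos,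
    LongRay.lt_ord_iff.2 (Order.lt_succ_iff.2 (height_fst_le hσ x.2))⟩,
    x.1.coord - shift s x.1.height)
  invFun q := ⟨point hS hs hσ q, mem_branch_iff.2 rfl⟩
  left_inv x := by
    refine Subtype.ext (TreeSurface.ext (mem_branch_iff.1 x.2).symm rfl ?_)
    simp [point]
  right_inv q := by
    refine Prod.ext rfl ?_
    simp [point]
  continuous_toFun := by
    refine Continuous.prodMk ((continuous_height.comp continuous_subtype_val).subtype_mk _) ?_
    refine OnePoint.isOpenEmbedding_coe.isInducing.continuous_iff.2 ?_
    exact ((continuous_branchCoord hs).comp continuous_subtype_val).congr fun x =>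
      branchCoord_of_eq (mem_branch_iff.1 x.2)
  continuous_invFun := (continuous_point hS hs hσ).subtype_mk _

end TreeSurface

/-! ### Open intervals of the long ray -/

theorem IsLocallyEuclidean.of_isOpen {n : ℕ} {X : Type*} [TopologicalSpace X]
    (h : IsLocallyEuclidean n X) {U : Set X} (hU : IsOpen U) : IsLocallyEuclidean n U :=
  h.of_charts fun x => by
    have : Nonempty U := ⟨x⟩
    exact ⟨hU.isOpenEmbedding_subtypeVal.toOpenPartialHomeomorph _, by simp⟩

theorem IsLocallyEuclidean.of_homeomorph {n : ℕ} {X Y : Type*} [TopologicalSpace X]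
    [TopologicalSpace Y] (h : IsLocallyEuclidean n Y) (e : X ≃ₜ Y) : IsLocallyEuclidean n X :=
  h.of_charts fun x => ⟨e.toOpenPartialHomeomorph, by simp⟩

theorem isLocallyEuclidean_real : IsLocallyEuclidean 1 ℝ := fun x => by
  have hfin : Module.finrank ℝ ℝ = Module.finrank ℝ (EuclideanSpace ℝ (Fin 1)) := by simp
  exact ⟨(ContinuousLinearEquiv.ofFinrankEq hfin).toHomeomorph.toOpenPartialHomeomorph, by simp⟩

theorem LongRay.exists_homeomorph_Ioo (α : Omega1) :
    ∃ c : ℝ, Nonempty (Ioo ⊥ (ord α) ≃ₜ Ioo (0 : ℝ) c) := by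
  obtain ⟨φ, ψ, hφ, h0, hs, hψ, hφψ⟩ := exists_coordinate α
  have hmem : ∀ r ∈ Ioo 0 (φ (ord α)), ψ r ∈ Ioo ⊥ (ord α) := fun r hr => by
    have h := hφψ r ⟨hr.1.le, hr.2.le⟩
    constructor
    · exact hφ.reflect_lt (by rw [h0, h]; exact hr.1)
    · exact hφ.reflect_lt (by rw [h]; exact hr.2)
  exact ⟨φ (ord α), ⟨{
    toFun := fun a => ⟨φ a, h0 ▸ hs (mem_Iic.2 bot_le) (mem_Iic.2 a.2.2.le) a.2.1,
      hs (mem_Iic.2 a.2.2.le) (mem_Iic.2 le_rfl) a.2.2⟩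
    invFun := fun r => ⟨ψ r, hmem r r.2⟩
    left_inv := fun a => Subtype.ext ((hψ a).trans (min_eq_left a.2.2.le))
    right_inv := fun r => Subtype.ext (hφψ r ⟨r.2.1.le, r.2.2.le⟩)
    continuous_toFun := by fun_prop
    continuous_invFun := by fun_prop }⟩⟩

theorem LongRay.isLocallyEuclidean_Ioo (α : Omega1) :
    IsLocallyEuclidean 1 (Ioo (⊥ : LongRay) (ord α)) := by
  obtain ⟨c, ⟨e⟩⟩ := exists_homeomorph_Ioo α
  exact (isLocallyEuclidean_real.of_isOpen isOpen_Ioo).of_homeomorph e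

theorem LongRay.secondCountable_Ioo (α : Omega1) :
    SecondCountableTopology (Ioo (⊥ : LongRay) (ord α)) := by
  obtain ⟨c, ⟨e⟩⟩ := exists_homeomorph_Ioo α
  exact e.isInducing.secondCountableTopology

namespace TreeSurface

variable {S : Set (Omega1 → ℕ)}

/-! #### Topological properties -/

theorem isLocallyEuclidean (hS : IsSequenceTree S) : IsLocallyEuclidean 2 (TreeSurface S) := by
  intro x
  obtain ⟨σ, hσ⟩ := hS.exists_length x.node x.node_mem
  have : Nonempty (branch S x.node) := ⟨⟨x, mem_branch_node x⟩⟩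
  obtain ⟨c, hc⟩ := ((LongRay.isLocallyEuclidean_Ioo (Order.succ σ)).prod_real.of_homeomorph
    (branchHomeomorph hS x.node_mem hσ)) ⟨x, mem_branch_node x⟩
  have hsymm : ((isOpen_branch x.node_mem).isOpenEmbedding_subtypeVal.toOpenPartialHomeomorph
      (Subtype.val : branch S x.node → _)).symm x = ⟨x, mem_branch_node x⟩ :=
    OpenPartialHomeomorph.left_inv _ (x := (⟨x, mem_branch_node x⟩ : branch S x.node)) (by simp)
  refine ⟨((isOpen_branch x.node_mem).isOpenEmbedding_subtypeVal.toOpenPartialHomeomorph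
    (Subtype.val : branch S x.node → _)).symm.trans c, ?_⟩
  rw [OpenPartialHomeomorph.trans_source, mem_inter_iff, mem_preimage, hsymm]
  exact ⟨by simp [mem_branch_node], hc⟩

theorem secondCountable_branch (hS : IsSequenceTree S) {s : Omega1 → ℕ} (hs : s ∈ S) :
    SecondCountableTopology (branch S s) := by
  obtain ⟨σ, hσ⟩ := hS.exists_length s hs
  have := LongRay.secondCountable_Ioo (Order.succ σ)
  exact (branchHomeomorph hS hs hσ).isInducing.secondCountableTopology

theorem isLindelof_of_subset_branch (hS : IsSequenceTree S) {s : Omega1 → ℕ} (hs : s ∈ S)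
    {A : Set (TreeSurface S)} (hA : A ⊆ branch S s) : IsLindelof A := by
  have := secondCountable_branch hS hs
  have h : IsLindelof (Subtype.val ⁻¹' A : Set (branch S s)) :=
    HereditarilyLindelofSpace.isLindelof _
  have := h.image continuous_subtype_val
  rwa [Subtype.image_preimage_val, inter_eq_right.2 hA] at this

theorem connectedSpace (hS : IsSequenceTree S) (hne : S.Nonempty) :
    ConnectedSpace (TreeSurface S) := by
  obtain ⟨s₀, hs₀⟩ := hne
  set o : Omega1 := (⊥ : LongRay).fst with ho
  have hbot : ∀ γ, ¬ γ < o := fun γ h => by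
    have := LongRay.fst_mono (bot_le (a := LongRay.ord γ))
    exact this.not_gt h
  -- A positive height above the root, where the node is the zero sequence; every branch contains
  -- this point.
  let h₀ : LongRay := LongRay.mk o ⟨1 / 2, by norm_num, by norm_num⟩
  let x₀ : TreeSurface S :=
    { node := truncate s₀ o
      height := h₀
      coord := 0
      node_mem := hS.truncate_mem s₀ hs₀ o
      node_ne_zero_iff := fun γ => by
        simp only [h₀, LongRay.fst_mk, hbot γ, iff_false, not_not]
        exact truncate_of_le (not_lt.1 (hbot γ))
      height_pos := by
        refine (LongRay.ord_le_iff.2 le_rfl : LongRay.ord o ≤ ⊥).antisymm bot_le ▸ ?_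
        exact LongRay.lt_iff.2 (Or.inr ⟨rfl, by simp [h₀]⟩) }
  refine { toNonempty := ⟨x₀⟩, isPreconnected_univ := ?_ }
  refine isPreconnected_of_forall x₀ fun x _ => ⟨branch S x.node, subset_univ _, ?_,
    mem_branch_node x, ?_⟩
  · refine mem_branch_iff.2 ?_
    ext γ
    change truncate s₀ o γ = truncate x.node o γ
    rw [truncate_of_le (not_lt.1 (hbot γ)), truncate_of_le (not_lt.1 (hbot γ))]
  · obtain ⟨σ, hσ⟩ := hS.exists_length x.node x.node_mem
    have : PreconnectedSpace (Ioo ⊥ (LongRay.ord (Order.succ σ))) :=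
      Subtype.preconnectedSpace isPreconnected_Ioo
    have : PreconnectedSpace (branch S x.node) :=
      (branchHomeomorph hS x.node_mem hσ).symm.surjective.denseRange.preconnectedSpace
        (branchHomeomorph hS x.node_mem hσ).symm.continuous
    exact isPreconnected_iff_preconnectedSpace.2 this

/-- The height as a continuous map. -/
noncomputable def heightMap : C(TreeSurface S, LongRay) := ⟨height, continuous_height⟩

/-- Points of height at most `a` lie on the branches of nodes of length at most `a.fst`; there are
countably many of these, each second countable. -/
theorem isExhaustion_heightMap (hS : IsSequenceTree S)
    (hc : ∀ β, {s ∈ S | s β = 0}.Countable) : IsExhaustion (heightMap (S := S)) := by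
  intro a
  have : {x : TreeSurface S | heightMap x ≤ a} = ⋃ s ∈ {s ∈ S | s a.fst = 0},
      {x | heightMap x ≤ a} ∩ branch S s := by
    ext x
    simp only [mem_iUnion, mem_inter_iff, exists_prop]
    constructor
    · intro hx
      refine ⟨x.node, ⟨x.node_mem, ?_⟩, hx, mem_branch_node x⟩
      by_contra h
      exact ((x.node_ne_zero_iff _).1 h).not_ge (LongRay.fst_mono hx)
    · rintro ⟨s, -, hx, -⟩
      exact hx
  rw [this]
  exact (hc _).isLindelof_biUnion fun s hs =>
    isLindelof_of_subset_branch hS hs.1 inter_subset_right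

theorem not_bddAbove_range_heightMap (hS : IsSequenceTree S) (h : ∀ β, ∃ s ∈ S, s β ≠ 0) :
    ¬ BddAbove (range (heightMap (S := S))) := by
  rintro ⟨b, hb⟩
  obtain ⟨s, hs, hsb⟩ := h b.fst
  obtain ⟨σ, hσ⟩ := hS.exists_length s hs
  have hlt := b.lt_ord_succ
  have hmem : LongRay.ord (Order.succ b.fst) ∈ Ioo ⊥ (LongRay.ord (Order.succ σ)) :=
    ⟨bot_le.trans_lt hlt, LongRay.ord_lt_ord.2 (Order.succ_lt_succ ((hσ _).1 hsb))⟩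
  exact hlt.not_ge (hb ⟨point hS hs hσ (⟨_, hmem⟩, 0), rfl⟩)

/-- Sets of points on a branch with bounded fiber coordinates and with heights in a compact interval
are relatively compact. -/
theorem exists_isCompact (hS : IsSequenceTree S) {s : Omega1 → ℕ} (hs : s ∈ S) {σ : Omega1}
    (hσ : ∀ γ, s γ ≠ 0 ↔ γ < σ) {a : LongRay} (ha : ⊥ < a) (r : ℝ) :
    ∃ K : Set (TreeSurface S), IsCompact K ∧ ∀ x ∈ branch S s, a ≤ x.height →
      x.height ≤ LongRay.ord σ → |x.coord - shift s x.height| ≤ r → x ∈ K := by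
  let e := branchHomeomorph hS hs hσ
  have h1 : IsCompact (Subtype.val ⁻¹' Icc a (LongRay.ord σ) :
      Set (Ioo ⊥ (LongRay.ord (Order.succ σ)))) := by
    rw [Topology.IsInducing.subtypeVal.isCompact_iff, Subtype.image_preimage_val,
      inter_eq_right.2]
    · exact isCompact_Icc
    · exact fun b hb => ⟨ha.trans_le hb.1,
        hb.2.trans_lt (LongRay.ord_lt_ord.2 (Order.lt_succ σ))⟩
  refine ⟨_, (h1.prod (isCompact_Icc (a := -r) (b := r))).image
    (continuous_subtype_val.comp e.symm.continuous), fun x hx hax hxσ hr => ?_⟩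
  exact ⟨e ⟨x, hx⟩, ⟨⟨hax, hxσ⟩, abs_le.1 hr⟩, by simp⟩

end TreeSurface

/-! ### The surface of a Suslin tree -/

namespace LeveledSuslinTree

variable {T : Type*} [PartialOrder T] (L : LeveledSuslinTree T)

theorem isSequenceTree : IsSequenceTree (range L.code) := by
  refine ⟨?_, ?_⟩
  · rintro _ ⟨t, rfl⟩
    exact ⟨L.ht t, fun γ => L.code_ne_zero_iff⟩
  · rintro _ ⟨t, rfl⟩ β
    rcases lt_or_ge β (L.ht t) with h | h
    · obtain ⟨s, hs, rfl⟩ := L.exists_lt t β h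
      refine ⟨s, funext fun γ => ?_⟩
      rcases lt_or_ge γ (L.ht s) with h' | h'
      · rw [truncate_of_lt h', L.code_eq_of_lt hs h']
      · rw [truncate_of_le h']
        by_contra hne
        exact (L.code_ne_zero_iff.1 hne).not_ge h'
    · exact ⟨t, (truncate_eq_self fun γ hγ => (L.code_ne_zero_iff.1 hγ).trans_le h).symm⟩

/-- The surface of a Suslin tree. -/
abbrev Surface : Type := TreeSurface (range L.code)

theorem exists_code_eq (x : L.Surface) : ∃ t, L.code t = x.node ∧ L.ht t = x.height.fst := by
  obtain ⟨t, ht⟩ := x.node_mem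
  refine ⟨t, ht, le_antisymm ?_ ?_⟩
  · by_contra! h
    have := L.code_ne_zero_iff.2 h
    rw [ht] at this
    exact lt_irrefl _ ((x.node_ne_zero_iff _).1 this)
  · by_contra! h
    have := (x.node_ne_zero_iff _).2 h
    rw [← ht] at this
    exact lt_irrefl _ (L.code_ne_zero_iff.1 this)

theorem countable_code_eq_zero (β : Omega1) : {s ∈ range L.code | s β = 0}.Countable := by
  refine ((L.countable_ht_le β).image L.code).mono ?_
  rintro _ ⟨⟨t, rfl⟩, ht⟩
  refine ⟨t, ?_, rfl⟩
  by_contra h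
  exact L.code_ne_zero_iff.2 (not_le.1 h) ht

theorem exists_ht_gt (β : Omega1) : ∃ t, β < L.ht t := by
  obtain ⟨t, -, ht⟩ := L.exists_ht_ge (A := univ)
    (fun h => L.not_countable (countable_univ_iff.1 h)) β
  exact ⟨t, ht⟩

theorem isExhaustion : IsExhaustion (TreeSurface.heightMap (S := range L.code)) :=
  TreeSurface.isExhaustion_heightMap L.isSequenceTree L.countable_code_eq_zero

theorem not_bddAbove_range :
    ¬ BddAbove (range (TreeSurface.heightMap (S := range L.code))) :=
  TreeSurface.not_bddAbove_range_heightMap L.isSequenceTree fun β => by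
    obtain ⟨t, ht⟩ := L.exists_ht_gt β
    exact ⟨_, ⟨t, rfl⟩, L.code_ne_zero_iff.2 ht⟩

theorem isTopManifold : IsTopManifold 2 L.Surface := by
  obtain ⟨t, -⟩ := L.exists_ht_gt (Classical.arbitrary _)
  exact ⟨inferInstance, TreeSurface.connectedSpace L.isSequenceTree ⟨_, t, rfl⟩,
    (TreeSurface.isLocallyEuclidean L.isSequenceTree).exists_homeomorph⟩

end LeveledSuslinTree

/-! ### `ω₁`-compactness and splitting for the surface of a Suslin tree -/

namespace LeveledSuslinTree

variable {T : Type*} [PartialOrder T] (L : LeveledSuslinTree T)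

theorem isOmega1Compact : IsOmega1Compact L.Surface := by
  intro D hD hD'
  by_contra hunc
  choose τ hτ hτh using L.exists_code_eq
  have hcount : ∀ t, (D ∩ TreeSurface.branch _ (L.code t)).Countable := fun t =>
    (TreeSurface.isLindelof_of_subset_branch L.isSequenceTree ⟨t, rfl⟩
      inter_subset_right).countable_of_isDiscrete (hD'.mono inter_subset_left)
  have himg : ∀ A ⊆ D, (τ '' A).Countable → A.Countable := fun A hA h => by
    refine (h.biUnion fun t _ => hcount t).mono fun x hx => ?_
    refine mem_iUnion₂.2 ⟨τ x, mem_image_of_mem _ hx, hA hx, ?_⟩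
    rw [hτ]
    exact TreeSurface.mem_branch_node x
  -- The distance to the zero section of any branch through `τ x`; it depends only on `x`, so one
  -- bound `n` serves all branches at once.
  let dist : L.Surface → ℝ := fun x =>
    |x.coord - L.num (τ x) * ((x.height.snd : ℝ) / (1 - x.height.snd))|
  obtain ⟨n, hn⟩ : ∃ n : ℕ, ¬ {x ∈ D | dist x ≤ n}.Countable := by
    by_contra! h
    refine hunc ((countable_iUnion h).mono fun x hx => ?_)
    obtain ⟨n, hn⟩ := exists_nat_ge (dist x)
    exact mem_iUnion.2 ⟨n, hx, hn⟩
  -- Cofinally many nodes below one `t` carry points of `D` within distance `n` of the zero section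
  -- of the branch `t`. A strip over a closed height interval of this branch is compact, so it
  -- contains only finitely many of them.
  obtain ⟨t, ⟨β₀, hβ₀⟩, ht⟩ := L.exists_cofinal fun h => hn (himg _ (sep_subset _ _) h)
  have hpos : (⊥ : LongRay) < LongRay.ord (Order.succ β₀) :=
    bot_le.trans_lt (LongRay.ord_lt_ord.2 (Order.lt_succ β₀))
  obtain ⟨K, hK, hKmem⟩ := TreeSurface.exists_isCompact L.isSequenceTree ⟨t, rfl⟩
    (fun γ => L.code_ne_zero_iff (t := t)) hpos n
  have hfin : (D ∩ K).Finite :=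
    (hK.inter_left hD).finite (hD'.mono inter_subset_left)
  -- Including `β₀` makes the set nonempty and keeps the next point above the lower end of the
  -- strip.
  have hheights : (insert β₀ ((fun x => x.height.fst) '' (D ∩ K) ∩ Iio (L.ht t))).Finite :=
    ((hfin.image _).subset inter_subset_left).insert _
  obtain ⟨β, hβ, hβmax⟩ := exists_max_image _ id hheights (insert_nonempty _ _)
  have hβt : β < L.ht t := by
    rcases hβ with rfl | hβ
    exacts [hβ₀, hβ.2]
  obtain ⟨_, ⟨x, ⟨hxD, hxn⟩, rfl⟩, hxt, hβx⟩ := ht β hβt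
  have hx : x ∈ TreeSurface.branch _ (L.code t) := by
    refine TreeSurface.mem_branch_iff.2 (funext fun γ => ?_)
    rw [← hτ, ← hτh]
    rcases lt_or_ge γ (L.ht (τ x)) with h | h
    · rw [truncate_of_lt h, L.code_eq_of_lt hxt h]
    · rw [truncate_of_le h]
      by_contra hne
      exact (L.code_ne_zero_iff.1 hne).not_ge h
  have hxlt : L.ht (τ x) < L.ht t := L.ht_strictMono hxt
  have hxK : x ∈ K := by
    refine hKmem x hx ?_ ?_ ?_
    · rw [LongRay.ord_le_iff, ← hτh]
      exact Order.succ_le_of_lt ((hβmax β₀ (mem_insert _ _)).trans_lt hβx)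
    · refine (LongRay.lt_ord_iff.2 ?_).le
      rwa [← hτh]
    · rw [TreeSurface.shift, ← hτh, L.code_of_lt hxt]
      exact hxn
  refine (hβmax (L.ht (τ x)) (mem_insert_of_mem _ ⟨⟨x, ⟨hxD, hxK⟩, (hτh x).symm⟩, hxlt⟩)).not_gt ?_
  exact hβx

/-- The height on the part of the surface above an element of the tree, and a truncation of the
height elsewhere. -/
noncomputable def heightAbove (t : T) : C(L.Surface, LongRay) where
  toFun x := open Classical in if x.node (L.ht t) = L.num t then x.height
    else min x.height (LongRay.ord (Order.succ (L.ht t)))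
  continuous_toFun := by
    refine continuous_iff_continuousAt.2 fun x => ?_
    have hev : ∀ᶠ y in 𝓝 x, y ∈ TreeSurface.branch _ x.node :=
      (TreeSurface.isOpen_branch x.node_mem).mem_nhds (TreeSurface.mem_branch_node x)
    by_cases h : x.node (L.ht t) = L.num t
    · refine TreeSurface.continuous_height.continuousAt.congr (hev.mono fun y hy => ?_)
      dsimp only
      split_ifs with hy'
      · rfl
      · rw [TreeSurface.mem_branch_iff.1 hy] at hy'
        -- A nearby point on the same branch can only miss the condition by being too low, and there
        -- the truncation has no effect.
        have hle : y.height.fst ≤ L.ht t := by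
          by_contra! hlt
          exact hy' (by rw [truncate_of_lt hlt, h])
        exact (min_eq_left (LongRay.lt_ord_iff.2 (Order.lt_succ_iff.2 hle)).le).symm
    · refine (TreeSurface.continuous_height.min continuous_const).continuousAt.congr
        (hev.mono fun y hy => (if_neg fun hy' => ?_).symm)
      rw [TreeSurface.mem_branch_iff.1 hy] at hy'
      rcases lt_or_ge (L.ht t) y.height.fst with hlt | hle
      · rw [truncate_of_lt hlt] at hy'
        exact h hy'
      · rw [truncate_of_le hle] at hy'
        exact L.num_ne_zero t hy'.symm

theorem heightAbove_of_eq {t : T} {x : L.Surface} (h : x.node (L.ht t) = L.num t) :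
    L.heightAbove t x = x.height := if_pos h

theorem heightAbove_le {t : T} {x : L.Surface} (h : x.node (L.ht t) ≠ L.num t) :
    L.heightAbove t x ≤ LongRay.ord (Order.succ (L.ht t)) :=
  (if_neg h : L.heightAbove t x = _).trans_le (min_le_right _ _)

theorem exists_not_bddAbove_above {A : Set L.Surface}
    (hA : ¬ BddAbove (TreeSurface.heightMap '' A)) (β : Omega1) :
    ∃ t, L.ht t = β ∧
      ¬ BddAbove (TreeSurface.heightMap '' {x ∈ A | x.node (L.ht t) = L.num t}) := by
  by_contra! h
  choose! c hc using fun t (ht : L.ht t = β) => h t ht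
  obtain ⟨b, hb⟩ := LongRay.bddAbove_of_countable (((L.countable_ht_le β).mono
    (fun t (ht : L.ht t = β) => ht.le)).image c)
  refine hA ⟨max b (LongRay.ord (Order.succ β)), forall_mem_image.2 fun x hx => ?_⟩
  by_contra! hlt
  obtain ⟨hbx, hβx⟩ := max_lt_iff.1 hlt
  have hβ : β < x.height.fst :=
    (Order.lt_succ β).trans_le (LongRay.ord_le_iff.1 hβx.le)
  obtain ⟨r, hr, hrh⟩ := L.exists_code_eq x
  obtain ⟨t, htr, rfl⟩ := L.exists_lt r β (by rwa [hrh])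
  have hxt : x.node (L.ht t) = L.num t := by rw [← hr, L.code_of_lt htr]
  exact ((hc t rfl (mem_image_of_mem _ ⟨hx, hxt⟩)).trans (hb ⟨t, rfl, rfl⟩)).not_gt hbx

/-- Unbounded sets in the surface of a Suslin tree are split by a map to the long ray. -/
theorem exists_split {A : Set L.Surface} (hA : ¬ BddAbove (TreeSurface.heightMap '' A)) :
    ∃ (F : C(L.Surface, LongRay)) (c : LongRay), ¬ BddAbove (F '' A) ∧
      ¬ BddAbove (TreeSurface.heightMap '' {x ∈ A | F x ≤ c}) := by
  set Z : Set T :=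
    {t | ¬ BddAbove (TreeSurface.heightMap '' {x ∈ A | x.node (L.ht t) = L.num t})} with hZ
  -- Levels are countable, so `Z` meets each of them and is uncountable, whereas chains are
  -- countable.
  have hchain : ¬ IsChain (· ≤ ·) Z := fun h => by
    refine not_countable_omega1 (countable_univ_iff.1
      (((L.isSuslinTree.countable_of_isChain Z h).image L.ht).mono fun β _ => ?_))
    obtain ⟨t, ht, htZ⟩ := L.exists_not_bddAbove_above hA β
    exact ⟨t, htZ, ht⟩
  -- The height above `t` is unbounded on `A`, but it is truncated on the unbounded part of `A`
  -- above the incomparable element `s`.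
  obtain ⟨t, htZ, s, hsZ, hne, hts⟩ : ∃ t ∈ Z, ∃ s ∈ Z, t ≠ s ∧ ¬ (t ≤ s ∨ s ≤ t) := by
    by_contra! h
    exact hchain fun t ht s hs hne => h t ht s hs hne
  refine ⟨L.heightAbove t, LongRay.ord (Order.succ (L.ht t)), fun h => htZ (h.mono ?_),
    fun h => hsZ (h.mono (image_mono ?_))⟩
  · rintro _ ⟨x, hx, rfl⟩
    exact ⟨x, hx.1, L.heightAbove_of_eq hx.2⟩
  · refine fun x hx => ⟨hx.1, L.heightAbove_le fun hxt => ?_⟩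
    obtain ⟨r, hr, -⟩ := L.exists_code_eq x
    have h1 : t < r := L.lt_of_code_eq (by rw [hr]; exact hxt)
    have h2 : s < r := L.lt_of_code_eq (by rw [hr]; exact hx.2)
    exact hts (L.le_or_le h1 h2)

end LeveledSuslinTree

theorem NotSH.exists_double (h : NotSH) :
    ∃ (M : Type) (_ : TopologicalSpace M), IsTopManifold 3 M ∧ IsTypeI M ∧ IsOmega1Compact M ∧
      SpannedByDirections M ∧ ∃ f : C(M, LongRay), ¬ BoundedOn f univ ∧
        ∀ D : Set M, IsDirection D → BoundedOn f D := by
  obtain ⟨T, _, hT⟩ := h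
  obtain ⟨L⟩ := hT.exists_leveled
  refine ⟨Double (TreeSurface.heightMap (S := range L.code)), inferInstance,
    Double.properties L.isTopManifold L.isExhaustion L.not_bddAbove_range L.isOmega1Compact ?_⟩
  intro D _ hD
  obtain ⟨F, c, hF, hc⟩ := L.exists_split (A := Double.base '' D) (by
    rw [image_image]
    exact hD)
  refine ⟨F, c, hF, fun hb => hc (hb.mono ?_)⟩
  rintro _ ⟨_, ⟨⟨p, hp, rfl⟩, hpc⟩, rfl⟩
  exact ⟨p, ⟨hp, hpc⟩, rfl⟩

end Directions

theorem theorem5p2 :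
    (Directions.NotSH →
      ∃ (M : Type) (_ : TopologicalSpace M), Directions.IsTopManifold 3 M ∧
        Directions.IsTypeI M ∧ Directions.IsOmega1Compact M ∧
        Directions.SpannedByDirections M ∧
        ∃ f : C(M, Directions.LongRay), ¬ Directions.BoundedOn f Set.univ ∧
          ∀ D : Set M, Directions.IsDirection D → Directions.BoundedOn f D) ∧
    ((Directions.DiamondPlus → Directions.NyikosSurface) → Directions.DiamondPlus →
      ∃ (M : Type) (_ : TopologicalSpace M), Directions.IsTopManifold 3 M ∧
        Directions.IsTypeI M ∧ Directions.IsOmegaBounded M ∧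
        Directions.SpannedByDirections M ∧
        ∃ f : C(M, Directions.LongRay), ¬ Directions.BoundedOn f Set.univ ∧
          ∀ D : Set M, Directions.IsDirection D → Directions.BoundedOn f D) :=
  ⟨fun h => h.exists_double, fun h h' => (h h').exists_double⟩
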